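/- Let $n\ge 2$. Let $T_n$ be the set of $n\times n$ permutation matrices $Y=(y_{ij})$ with $y_{ij}=0$ for $j\ge i+2$, and let $P_n$ be the convex hull of $T_n$. Let $v_n$ be the minimum of the $\binom n2$-dimensional volumes of the nondegenerate $\binom n2$-dimensional simplices whose vertices lie in the affine lattice spanned by $T_n$ (the set of integer affine combinations of elements of $T_n$); the relative volume of $P_n$ is its $\binom n2$-dimensional volume divided by $v_n$. Let $V$ be the space of real triangular arrays $(x_{ij})_{1\le j\le i\le n-1}$, with Lebesgue measure, and let $S\subset V$ be the unit simplex of nonnegative arrays whose entries have sum $\le 1$. Let $\mathcal A_n$ be the set of triangular arrays of nonnegative integers $(a_{ij})_{2\le j\le i\le n-1}$ such that $$\sum_{i=k}^{n-1}a_{ik}\le (k-2)+\sum_{j=2}^{k-1}a_{k-1,j}\qquad (2\le k\le n-1).$$ Fix an arbitrary linear order on the variables $x_{ij}$. For $\alpha=(a_{ij})\in\mathcal A_n$, a triangle of linear functions of the $x_{ij}$ is formed as follows. Start with $x_{ij}$ in position $(i,j)$. For $k=1,\dots,n-2$ in turn, list in the given order the variables occurring in row $k$ of the current triangle as $z_1,\dots,z_N$.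 Divide an initial part of this list into consecutive chunks: the first $a_{k+1,k+1}$ variables form the chunk of $a_{k+1,k+1}$, the next $a_{k+2,k+1}$ variables form the chunk of $a_{k+2,k+1}$, and so on down to $a_{n-1,k+1}$. The cap of the chunk of $a_{i,k+1}$ is the first $z_m$ that lies in none of the chunks of $a_{k+1,k+1},\dots,a_{i,k+1}$. Then, for every $i=k+1,\dots,n-1$, replace every occurrence of the cap $z$ of the chunk of $a_{i,k+1}$ in columns $1,\dots,k$ by $z+x_{i,k+1}$; after that, in column $k+1$, replace each variable $x_{i,k+1}$ by itself plus the sum of the variables in the chunk of $a_{i,k+1}$. The triangle obtained after the step $k=n-2$ defines a linear map $L(\alpha):V\to V$ with integer coefficients. Then: 1. The map sending $Y\in P_n$ to the array $(y_{ij})_{1\le j\le i\le n-1}$ is injective on $P_n$; by means of it $P_n$ is regarded as a subset of $V$ in parts 3 and 5. 2. The construction is well defined: for each $\alpha\in\mathcal A_n$ and each $k$ with $1\le k\le n-2$, $N>\sum_{i=k+1}^{n-1}a_{i,k+1}$ at the step $k$, so all caps exist. 3. For each $\alpha\in\mathcal A_n$, $\det L(\alpha)=1$, the simplex $L(\alpha)(S)$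 is contained in $P_n$ and has volume $1/\binom n2!$ in $V$, and the set of matrices in $P_n$ whose triangular arrays lie in $L(\alpha)(S)$ has the minimal volume $v_n$. 4. For distinct $\alpha,\beta\in\mathcal A_n$ the simplices $L(\alpha)(S)$ and $L(\beta)(S)$ have disjoint interiors in $V$. 5. $\bigcup_{\alpha\in\mathcal A_n}L(\alpha)(S)=P_n$. 6. The minimum $v_n$ exists and $0<v_n<\infty$, the set $\mathcal A_n$ is finite, and the relative volume of $P_n$ equals $|\mathcal A_n|$. -/

import Mathlib

open MeasureTheory

noncomputable section

/-- Positions `(i, j)` (row, column; both counted from 1) with `lo ≤ j ≤ i ≤ n - 1`. -/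
def TriIdx (lo n : ℕ) : Type :=
  {p : ℕ × ℕ // lo ≤ p.2 ∧ p.2 ≤ p.1 ∧ p.1 < n}

instance (lo n : ℕ) : DecidableEq (TriIdx lo n) :=
  inferInstanceAs (DecidableEq {p : ℕ × ℕ // lo ≤ p.2 ∧ p.2 ≤ p.1 ∧ p.1 < n})

instance (lo n : ℕ) : Fintype (TriIdx lo n) :=
  Fintype.subtype
    ((Finset.range n ×ˢ Finset.range n).filter
      (fun p : ℕ × ℕ => lo ≤ p.2 ∧ p.2 ≤ p.1 ∧ p.1 < n))
    (by
      intro p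
      simp only [Finset.mem_filter, Finset.mem_product, Finset.mem_range]
      constructor
      · exact fun h => h.2
      · exact fun h => ⟨⟨h.2.2, lt_of_le_of_lt h.2.1 h.2.2⟩, h⟩)

def TriIdx.row {lo n : ℕ} (p : TriIdx lo n) : ℕ := p.1.1

def TriIdx.col {lo n : ℕ} (p : TriIdx lo n) : ℕ := p.1.2

/-- Positions of the variables `x_{ij}`, `1 ≤ j ≤ i ≤ n - 1`. -/
abbrev VarIdx (n : ℕ) : Type := TriIdx 1 n

/-- Positions of the entries `a_{ij}`, `2 ≤ j ≤ i ≤ n - 1`. -/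
abbrev ArrIdx (n : ℕ) : Type := TriIdx 2 n

/-! ### The polytope and its relative volume -/

/-- The set `T_n` of `n × n` permutation matrices whose entries `(i, j)` vanish for `j ≥ i + 2`. -/
def permSet (n : ℕ) : Set (Matrix (Fin n) (Fin n) ℝ) :=
  {Y | (∃ σ : Equiv.Perm (Fin n), Y = σ.permMatrix ℝ) ∧
    ∀ i j : Fin n, (i : ℕ) + 2 ≤ (j : ℕ) → Y i j = 0}

/-- The polytope `P_n`, the convex hull of `T_n`. -/
def polytopeP (n : ℕ) : Set (Matrix (Fin n) (Fin n) ℝ) := convexHull ℝ (permSet n)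

/-- `C(n,2)`-dimensional Euclidean volume of a set of `n × n` real matrices. -/
def matVol (n : ℕ) (s : Set (Matrix (Fin n) (Fin n) ℝ)) : ENNReal :=
  μHE[n.choose 2]
    ((fun Y : Matrix (Fin n) (Fin n) ℝ =>
      (WithLp.toLp 2 (fun p : Fin n × Fin n => Y p.1 p.2) :
        EuclideanSpace ℝ (Fin n × Fin n))) '' s)

/-- The volumes of the (nondegenerate) `C(n,2)`-dimensional simplices all of whose vertices lie in
the affine lattice spanned by `T_n`, the set of integer affine combinations of elements of `T_n`. -/
def latticeSimplexVolumes (n : ℕ) : Set ENNReal :=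
  {w | ∃ v : Fin (n.choose 2 + 1) → Matrix (Fin n) (Fin n) ℝ,
    AffineIndependent ℝ v ∧ (∀ i, v i ∈ affineSpan ℤ (permSet n)) ∧
      w = matVol n (convexHull ℝ (Set.range v))}

/-- The minimum `v_n` of those volumes. -/
def minSimplexVol (n : ℕ) : ENNReal := sInf (latticeSimplexVolumes n)

/-- The relative volume `V_n` of `P_n`: its volume in units of `v_n`. -/
def relVolP (n : ℕ) : ENNReal := matVol n (polytopeP n) / minSimplexVol n

/-- The triangular array `(y_{ij})_{1 ≤ j ≤ i ≤ n - 1}` of a matrix; as matrices are indexed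
from 0 here, `y_{ij}` is the entry at `(i - 1, j - 1)`. -/
def toTri {n : ℕ} (Y : Matrix (Fin n) (Fin n) ℝ) : VarIdx n → ℝ :=
  fun p => Y ⟨p.row - 1, lt_of_le_of_lt (Nat.sub_le _ _) p.2.2.2⟩
    ⟨p.col - 1, lt_of_le_of_lt (Nat.sub_le _ _) (lt_of_le_of_lt p.2.2.1 p.2.2.2)⟩

/-! ### The set `𝒜_n` -/

/-- The entry `a_{ij}` of the array `α` (zero at positions outside the triangle). -/
def arrEntry {n : ℕ} (α : ArrIdx n → ℕ) (i j : ℕ) : ℕ :=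
  if h : 2 ≤ j ∧ j ≤ i ∧ i < n then α ⟨(i, j), h⟩ else 0

/-- The set `𝒜_n`: for `2 ≤ k ≤ n - 1`, the sum of column `k` is at most `k - 2` plus the sum
of row `k - 1`. -/
def arraySet (n : ℕ) : Set (ArrIdx n → ℕ) :=
  {α | ∀ k : ℕ, 2 ≤ k → k < n →
    ∑ i ∈ Finset.Ico k n, arrEntry α i k
      ≤ (k - 2) + ∑ j ∈ Finset.Ico 2 k, arrEntry α (k - 1) j}

/-! ### The construction of `L(α)` -/

/-- A triangle of linear functions of the variables `x_q`: the linear function in position `p`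
is `∑ q, M p q * x_q`. -/
abbrev LinTri (n : ℕ) : Type := Matrix (VarIdx n) (VarIdx n) ℤ

/-- The initial triangle, with `x_p` in position `p`. -/
def initTri (n : ℕ) : LinTri n := 1

/-- The variables occurring in row `k` of the triangle `M`, listed in the assigned order. -/
def rowVars {n : ℕ} (ord : LinearOrder (VarIdx n)) (M : LinTri n) (k : ℕ) : List (VarIdx n) :=
  (Finset.univ.filter (fun q : VarIdx n => ∃ p : VarIdx n, p.row = k ∧ M p q ≠ 0)).sort
    (fun a b => ord.le a b)

/-- The total size of the chunks of column `c` of `α` that belong to rows `c, …, i - 1`. -/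
def chunkStart {n : ℕ} (α : ArrIdx n → ℕ) (c i : ℕ) : ℕ :=
  ∑ t ∈ Finset.Ico c i, arrEntry α t c

/-- The chunk of `a_{ic}` in the list `z`: the next `a_{ic}` variables after the chunks of
`a_{cc}, …, a_{i-1,c}`. -/
def chunk {n : ℕ} (α : ArrIdx n → ℕ) (z : List (VarIdx n)) (c i : ℕ) : List (VarIdx n) :=
  (z.drop (chunkStart α c i)).take (arrEntry α i c)

/-- The cap of the chunk of `a_{ic}`: the first variable of `z` that lies in none of the chunks of
`a_{cc}, …, a_{ic}`. -/
def cap {n : ℕ} (α : ArrIdx n → ℕ) (z : List (VarIdx n)) (c i : ℕ) : Option (VarIdx n) :=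
  z[chunkStart α c (i + 1)]?

/-- The step that uses column `k + 1` of `α`. In columns `1, …, k` of the triangle the cap `z` of
each `a_{i,k+1}` is replaced by `z + x_{i,k+1}`; in column `k + 1` each variable `x_{i,k+1}` is
replaced by itself plus the sum of the variables in the chunk of `a_{i,k+1}`. -/
def stepTri {n : ℕ} (ord : LinearOrder (VarIdx n)) (α : ArrIdx n → ℕ) (k : ℕ) (M : LinTri n) :
    LinTri n := fun p q =>
  if p.col ≤ k then
    M p q + (if q.col = k + 1 then
      (match cap α (rowVars ord M k) (k + 1) q.row with
        | some z => M p z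
        | none => 0) else 0)
  else if p.col = k + 1 then
    M p q + ∑ x : VarIdx n,
      (if x.col = k + 1 ∧ q ∈ chunk α (rowVars ord M k) (k + 1) x.row then M p x else 0)
  else M p q

/-- The triangle after the first `m` steps, which use the columns `2, …, m + 1` of `α`. -/
def stageTri {n : ℕ} (ord : LinearOrder (VarIdx n)) (α : ArrIdx n → ℕ) : ℕ → LinTri n
  | 0 => initTri n
  | m + 1 => stepTri ord α (m + 1) (stageTri ord α m)

/-- The linear map `L(α)` given by the triangle obtained after all columns `2, …, n - 1` of `α`
have been used. -/
def mapL {n : ℕ} (ord : LinearOrder (VarIdx n)) (α : ArrIdx n → ℕ) :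
    (VarIdx n → ℝ) →ₗ[ℝ] (VarIdx n → ℝ) :=
  Matrix.mulVecLin ((stageTri ord α (n - 2)).map (Int.cast : ℤ → ℝ))

/-- The unit simplex `S`. -/
def unitSimplex (n : ℕ) : Set (VarIdx n → ℝ) :=
  {x | (∀ p, 0 ≤ x p) ∧ ∑ p, x p ≤ 1}

/-- The simplex `L(α)(S)`. -/
def simplexL {n : ℕ} (ord : LinearOrder (VarIdx n)) (α : ArrIdx n → ℕ) : Set (VarIdx n → ℝ) :=
  mapL ord α '' unitSimplex n

end

/-!
In the coordinates `y_{ij}`, `1 ≤ j ≤ i ≤ n - 1`, a matrix of `P_n` is recovered from its row and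
column sums (`fillMat_toTri`), and `P_n` becomes the region `FlowRegion`: all coordinates are
nonnegative, the sum of column 1 is at most 1, and for `k ≥ 2` the sum of column `k` is at most the
sum of row `k - 1`. One inclusion holds because the remaining entries of a doubly stochastic matrix
are nonnegative; the other follows from the triangulation itself, since a point of the region with
integer coordinates fills up to a permutation matrix (`fillMat_mem_permSet`).

The triangulation is found one column at a time. After `m` steps the variables of the columns up to
`m + 1` range over a unit simplex, and the sum of row `m + 1` is the sum of the variables
`z_1, …, z_N` occurring in it (`rowSum_stageApply`), because every variable occurs there at most
once (`StageInv`). The next column, `w_1, w_2, …`, only has to satisfy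
`w_1 + w_2 + ⋯ ≤ z_1 + ⋯ + z_N`. Lay the `z`'s and the `w`'s end to end on a line. Each endpoint of
a `w` cuts one of the `z`'s, its cap, and every `w` consists of a number of remaining pieces of
`z`'s, its chunk, and of the part cut off from its cap, its new variable. Hence `w` together with
`z` is the image of the nonnegative vector of the pieces under a linear substitution, which is the
step of the construction (`substMat`, `stageTri_succ`). The numbers of pieces used form the new
column of the array. They exist for every `w` that fits (`exists_cut`), they are determined when all
pieces are positive (`IsCut.chunkStart_eq`), and their sum is less than `N`, which is the inequality
defining `𝒜_n` since row `m + 1` contains `m + 1 + ∑ j, a_{m+1,j}` variables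
(`StageInv.isCut_iff`). A substitution has determinant one because its matrix is triangular with
respect to the order of the cuts on the line (`IsCut.det_substMat`), and it preserves the sum of the
variables (`IsCut.sum_col_lt_subst`). Iterating, the simplices `L(α)(S)` cover the region, have
disjoint interiors and the volume of the unit simplex.

For the relative volume, `fillMat` multiplies volumes by a constant (`exists_matVol_eq_mul`), the
points of the affine lattice spanned by `T_n` have integer coordinates, and the volume of a
nondegenerate simplex with integer vertices is at least that of the unit simplex, so that the
simplices `L(α)(S)`, whose vertices lie in `T_n`, have minimal volume.
-/

/-! ### Volumes of simplices -/

theorem measurableSet_simplex {ι : Type*} [Fintype ι] (r : ℝ) :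
    MeasurableSet {x : ι → ℝ | (∀ i, 0 ≤ x i) ∧ ∑ i, x i ≤ r} := by
  have h : IsClosed {x : ι → ℝ | (∀ i, 0 ≤ x i) ∧ ∑ i, x i ≤ r} := by
    have h1 : IsClosed {x : ι → ℝ | ∀ i, 0 ≤ x i} := by
      simp only [Set.ofPred_forall]
      exact isClosed_iInter fun i => isClosed_le continuous_const (continuous_apply i)
    exact h1.inter (isClosed_le (f := fun x : ι → ℝ => ∑ i, x i) (by fun_prop) continuous_const)
  exact h.measurableSet

theorem volume_simplex_fin (d : ℕ) : ∀ r : ℝ, 0 ≤ r →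
    volume {x : Fin d → ℝ | (∀ i, 0 ≤ x i) ∧ ∑ i, x i ≤ r} =
      ENNReal.ofReal (r ^ d / d.factorial) := by
  induction d with
  | zero =>
    intro r hr
    have : {x : Fin 0 → ℝ | (∀ i, 0 ≤ x i) ∧ ∑ i, x i ≤ r} = Set.univ := by
      ext x; simp [hr]
    rw [this]
    simp [volume_pi]
  | succ d ih =>
    intro r hr
    let B : Set (ℝ × (Fin d → ℝ)) := {p | 0 ≤ p.1 ∧ (∀ i, 0 ≤ p.2 i) ∧ p.1 + ∑ i, p.2 i ≤ r}
    have hB : MeasurableSet B := by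
      have h : IsClosed B := by
        have h1 : IsClosed {p : ℝ × (Fin d → ℝ) | ∀ i, 0 ≤ p.2 i} := by
          simp only [Set.ofPred_forall]
          exact isClosed_iInter fun i => isClosed_le continuous_const (by fun_prop)
        exact (isClosed_le continuous_const continuous_fst).inter
          (h1.inter (isClosed_le (f := fun p : ℝ × (Fin d → ℝ) => p.1 + ∑ i, p.2 i) (by fun_prop)
            continuous_const))
      exact h.measurableSet
    have hpre : {x : Fin (d + 1) → ℝ | (∀ i, 0 ≤ x i) ∧ ∑ i, x i ≤ r} =
        (MeasurableEquiv.piFinSuccAbove (fun _ : Fin (d + 1) => ℝ) 0) ⁻¹' B := by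
      ext x
      simp [B, MeasurableEquiv.piFinSuccAbove, Fin.forall_fin_succ, Fin.sum_univ_succ, and_assoc,
        Fin.tail]
    rw [hpre, (volume_preserving_piFinSuccAbove (fun _ : Fin (d + 1) => ℝ) 0).measure_preimage
      hB.nullMeasurableSet, Measure.volume_eq_prod, Measure.prod_apply hB]
    -- The slice at `t` is a simplex of size `r - t` when `0 ≤ t ≤ r`, and empty otherwise.
    have hslice : ∀ t : ℝ, volume (Prod.mk t ⁻¹' B) =
        (Set.Icc 0 r).indicator (fun t => ENNReal.ofReal ((r - t) ^ d / d.factorial)) t := by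
      intro t
      by_cases ht : t ∈ Set.Icc 0 r
      · rw [Set.indicator_of_mem ht, ← ih (r - t) (by linarith [ht.2])]
        congr 1
        ext y
        simp [B, ht.1, le_sub_iff_add_le']
      · rw [Set.indicator_of_notMem ht]
        have : Prod.mk t ⁻¹' B = ∅ := by
          ext y
          simp only [B, Set.mem_preimage, Set.mem_ofPred_eq, Set.mem_empty_iff_false, iff_false]
          rintro ⟨h1, h2, h3⟩
          exact ht ⟨h1, by linarith [Finset.sum_nonneg fun i (_ : i ∈ Finset.univ) => h2 i]⟩
        rw [this, measure_empty]
    rw [lintegral_congr hslice, lintegral_indicator measurableSet_Icc,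
      ← ofReal_integral_eq_lintegral_ofReal]
    · congr 1
      rw [integral_Icc_eq_integral_Ioc, ← intervalIntegral.integral_of_le hr,
        intervalIntegral.integral_div,
        intervalIntegral.integral_comp_sub_left (fun t => t ^ d) r]
      simp only [sub_self, sub_zero, integral_pow]
      rw [Nat.factorial_succ]
      push_cast
      field_simp
      simp
    · exact (Continuous.continuousOn (by fun_prop)).integrableOn_Icc
    · filter_upwards [ae_restrict_mem measurableSet_Icc] with t ht
      have : 0 ≤ r - t := by linarith [ht.2]
      positivity

theorem volume_unit_simplex {ι : Type*} [Fintype ι] :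
    volume {x : ι → ℝ | (∀ i, 0 ≤ x i) ∧ ∑ i, x i ≤ 1} =
      ((Fintype.card ι).factorial : ENNReal)⁻¹ := by
  let e := Fintype.equivFin ι
  have h := (volume_measurePreserving_piCongrLeft (fun _ : ι => ℝ) e.symm).measure_preimage
    (measurableSet_simplex (ι := ι) 1).nullMeasurableSet
  rw [← h]
  have hs : (MeasurableEquiv.piCongrLeft (fun _ : ι => ℝ) e.symm) ⁻¹'
      {x : ι → ℝ | (∀ i, 0 ≤ x i) ∧ ∑ i, x i ≤ 1} =
      {x : Fin (Fintype.card ι) → ℝ | (∀ i, 0 ≤ x i) ∧ ∑ i, x i ≤ 1} := by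
    ext x
    have hx : ∀ i, (MeasurableEquiv.piCongrLeft (fun _ : ι => ℝ) e.symm) x (e.symm i) = x i :=
      fun i => MeasurableEquiv.piCongrLeft_apply_apply _ _ _
    simp only [Set.mem_preimage, Set.mem_ofPred_eq, ← e.symm.sum_comp, hx]
    rw [← e.symm.forall_congr_right]
    simp only [hx]
  rw [hs, volume_simplex_fin _ 1 zero_le_one]
  rw [one_pow, one_div, ENNReal.ofReal_inv_of_pos (by positivity), ENNReal.ofReal_natCast]

/-- A square matrix with unit diagonal all of whose other nonzero entries go from higher to lower
values of a weight `f` has determinant one. -/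
theorem det_eq_one_of_weight {ι R : Type*} [Fintype ι] [DecidableEq ι] [CommRing R]
    (M : Matrix ι ι R) (f : ι → ℕ) (h1 : ∀ i, M i i = 1)
    (h2 : ∀ i j, i ≠ j → M i j ≠ 0 → f j < f i) : M.det = 1 := by
  have hM : M.BlockTriangular (fun i => OrderDual.toDual (f i)) := by
    intro i j hij
    by_contra h
    have hne : i ≠ j := by rintro rfl; exact lt_irrefl _ hij
    exact lt_asymm (h2 i j hne h) hij
  rw [hM.det]
  refine Finset.prod_eq_one fun a _ => ?_
  have : M.toSquareBlock (fun i => OrderDual.toDual (f i)) a = 1 := by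
    ext ⟨i, hi⟩ ⟨j, hj⟩
    simp only [Matrix.toSquareBlock_def, Matrix.of_apply, Matrix.one_apply, Subtype.mk.injEq]
    split_ifs with h
    · subst h; exact h1 i
    · by_contra hne
      have := h2 i j h hne
      have e : f i = f j := OrderDual.toDual.injective (hi.trans hj.symm)
      omega
  rw [this, Matrix.det_one]

theorem convex_simplex {ι : Type*} [Fintype ι] (r : ℝ) :
    Convex ℝ {x : ι → ℝ | (∀ i, 0 ≤ x i) ∧ ∑ i, x i ≤ r} := by
  rintro x ⟨hx1, hx2⟩ y ⟨hy1, hy2⟩ a b ha hb hab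
  refine ⟨fun i => ?_, ?_⟩
  · simp only [Pi.add_apply, Pi.smul_apply, smul_eq_mul]
    exact add_nonneg (mul_nonneg ha (hx1 i)) (mul_nonneg hb (hy1 i))
  · simp only [Pi.add_apply, Pi.smul_apply, smul_eq_mul, Finset.sum_add_distrib, ← Finset.mul_sum]
    calc _ ≤ a * r + b * r := add_le_add (mul_le_mul_of_nonneg_left hx2 ha)
          (mul_le_mul_of_nonneg_left hy2 hb)
      _ = r := by rw [← add_mul, hab, one_mul]

/-- A simplex is the image of the unit simplex under the affine map given by its edge vectors at
one vertex. -/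
theorem convexHull_range_eq_image_simplex {ι E : Type*} [Fintype ι] [AddCommGroup E] [Module ℝ E]
    (v : Option ι → E) :
    convexHull ℝ (Set.range v) =
      (fun x : ι → ℝ => v none + ∑ i, x i • (v (some i) - v none)) ''
        {x : ι → ℝ | (∀ i, 0 ≤ x i) ∧ ∑ i, x i ≤ 1} := by
  classical
  apply Set.Subset.antisymm
  · apply convexHull_min
    · rintro _ ⟨o, rfl⟩
      cases o with
      | none => exact ⟨0, by simp, by simp⟩
      | some i =>
        refine ⟨Pi.single i 1, ⟨fun j => ?_, by simp⟩, ?_⟩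
        · by_cases h : j = i
          · subst h; simp
          · simp [h]
        · simp [Pi.single_apply]
    · have h := (convex_simplex (ι := ι) 1).linear_image
        (Fintype.linearCombination ℝ (fun i => v (some i) - v none))
      have h2 := h.translate (v none)
      rw [Set.image_image] at h2
      exact h2
  · rintro _ ⟨x, ⟨hx1, hx2⟩, rfl⟩
    have : v none + ∑ i, x i • (v (some i) - v none) =
        ∑ o : Option ι, (o.elim (1 - ∑ i, x i) x) • v o := by
      simp only [Fintype.sum_option, Option.elim, smul_sub, Finset.sum_sub_distrib, sub_smul,
        one_smul, Finset.sum_smul]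
      abel
    simp only [this]
    apply (convex_convexHull ℝ (Set.range v)).sum_mem
    · rintro (_ | i) _
      · simpa using hx2
      · exact hx1 i
    · simp [Fintype.sum_option]
    · intro o _
      exact subset_convexHull ℝ _ ⟨o, rfl⟩

theorem volume_convexHull_range {ι : Type*} [Fintype ι] [DecidableEq ι] (v : Option ι → ι → ℝ) :
    volume (convexHull ℝ (Set.range v)) =
      ENNReal.ofReal |(Matrix.of fun a i => v (some i) a - v none a).det| *
        ((Fintype.card ι).factorial : ENNReal)⁻¹ := by
  rw [convexHull_range_eq_image_simplex]
  have h : (fun x : ι → ℝ => v none + ∑ i, x i • (v (some i) - v none)) =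
      (fun y => v none + y) ∘
        (Matrix.mulVecLin (Matrix.of fun a i => v (some i) a - v none a)) := by
    funext x a
    simp [Matrix.mulVec, dotProduct, mul_comm]
  rw [h, Set.image_comp, Set.image_add_left, measure_preimage_add,
    Measure.addHaar_image_linearMap, volume_unit_simplex, ← Matrix.toLin'_apply',
    LinearMap.det_toLin']

/-- The volume of a nondegenerate simplex with integer vertices is at least that of the unit
simplex, because the determinant of its edge vectors is a nonzero integer. -/
theorem le_volume_convexHull_range_of_int {ι : Type*} [Fintype ι] [DecidableEq ι]
    (v : Option ι → ι → ℝ) (hv : AffineIndependent ℝ v) (hint : ∀ o i, ∃ m : ℤ, v o i = m) :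
    ((Fintype.card ι).factorial : ENNReal)⁻¹ ≤ volume (convexHull ℝ (Set.range v)) := by
  rw [volume_convexHull_range]
  choose m hm using hint
  set A : Matrix ι ι ℤ := Matrix.of fun a i => m (some i) a - m none a with hA
  have hAv : (Matrix.of fun a i => v (some i) a - v none a) = A.map (Int.castRingHom ℝ) := by
    ext a i
    simp [A, hm]
  have hdet : (A.map (Int.castRingHom ℝ)).det = ((A.det : ℤ) : ℝ) := by
    have := (Int.castRingHom ℝ).map_det A
    simpa using this.symm
  have hne : (A.map (Int.castRingHom ℝ)).det ≠ 0 := by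
    rw [← hAv]
    have hl := (affineIndependent_iff_linearIndependent_vsub ℝ v none).1 hv
    have hl2 := hl.comp (fun i : ι => (⟨some i, by simp⟩ : {x : Option ι // x ≠ none}))
      (fun i j h => by simpa using h)
    have hu := Matrix.linearIndependent_cols_iff_isUnit.1
      (show LinearIndependent ℝ (Matrix.of fun a i => v (some i) a - v none a).col from hl2)
    exact ((Matrix.isUnit_iff_isUnit_det _).1 hu).ne_zero
  rw [hAv]
  rw [hdet] at hne ⊢
  have h1 : (1 : ℝ) ≤ |((A.det : ℤ) : ℝ)| := by
    have : A.det ≠ 0 := by exact_mod_cast hne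
    exact_mod_cast Int.one_le_abs this
  calc _ = 1 * ((Fintype.card ι).factorial : ENNReal)⁻¹ := (one_mul _).symm
    _ ≤ _ := by
      gcongr
      exact ENNReal.one_le_ofReal.2 h1

/-- An injective affine map into a Euclidean space multiplies the volume of every set by the same
positive finite factor. -/
theorem exists_euclideanHausdorffMeasure_image_eq_mul {ι κ : Type*} [Fintype ι] [Fintype κ]
    (φ : (ι → ℝ) →ₗ[ℝ] EuclideanSpace ℝ κ) (hφ : Function.Injective φ)
    (b : EuclideanSpace ℝ κ) :
    ∃ c : ENNReal, c ≠ 0 ∧ c ≠ ⊤ ∧ ∀ A : Set (ι → ℝ),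
      μHE[Fintype.card ι] ((fun x => b + φ x) '' A) = c * volume A := by
  let ψ : EuclideanSpace ℝ ι →ₗ[ℝ] EuclideanSpace ℝ κ :=
    φ ∘ₗ (WithLp.linearEquiv 2 ℝ (ι → ℝ)).toLinearMap
  have hψ : Function.Injective ψ := hφ.comp (WithLp.linearEquiv 2 ℝ (ι → ℝ)).injective
  refine ⟨ENNReal.ofReal ψ.normDet, ?_, ENNReal.ofReal_ne_top, fun A => ?_⟩
  · have h0 : ψ.normDet ≠ 0 := by
      intro h
      exact LinearMap.normDet_eq_zero_iff_ker_ne_bot.1 h (LinearMap.ker_eq_bot.2 hψ)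
    have := lt_of_le_of_ne ψ.normDet_nonneg h0.symm
    simpa using this
  · have h := ψ.euclideanHausdorffMeasure_image_eq_normDet_mul_volume (WithLp.toLp 2 '' A)
    rw [finrank_euclideanSpace] at h
    have hA : volume (WithLp.toLp 2 '' A : Set (EuclideanSpace ℝ ι)) = volume A := by
      have h2 : MeasurePreserving (MeasurableEquiv.toLp 2 (ι → ℝ)) :=
        PiLp.volume_preserving_toLp ι
      rw [← h2.measure_preimage_equiv]
      congr 1
      exact Set.preimage_image_eq A (MeasurableEquiv.toLp 2 (ι → ℝ)).injective
    have hi : (fun x => b + φ x) '' A = (fun y => b + y) '' (ψ '' (WithLp.toLp 2 '' A)) := by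
      rw [Set.image_image, Set.image_image]
      rfl
    rw [hi, (isometry_add_left b).euclideanHausdorffMeasure_image, h, hA]

/-! ### One step of the construction as a linear substitution -/

/-- The entry `u_{ij}` of a real triangular array, extended by zero outside the triangle. -/
noncomputable def triEntry {n : ℕ} (u : VarIdx n → ℝ) (i j : ℕ) : ℝ :=
  if h : 1 ≤ j ∧ j ≤ i ∧ i < n then u ⟨(i, j), h⟩ else 0

theorem triEntry_row_col {n : ℕ} (u : VarIdx n → ℝ) (q : VarIdx n) :
    triEntry u q.row q.col = u q := by
  unfold triEntry TriIdx.row TriIdx.col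
  rw [dif_pos q.2]
  rfl

theorem exists_row_col {n i j : ℕ} (hj : 1 ≤ j) (hji : j ≤ i) (hi : i < n) :
    ∃ p : VarIdx n, p.row = i ∧ p.col = j :=
  ⟨⟨(i, j), hj, hji, hi⟩, rfl, rfl⟩

theorem triEntry_nonneg {n : ℕ} {u : VarIdx n → ℝ} (hu : ∀ q, 0 ≤ u q) (i j : ℕ) :
    0 ≤ triEntry u i j := by
  unfold triEntry
  split_ifs
  · exact hu _
  · exact le_rfl

/-- The value of `u` at the variable at place `m` of a list, or zero past its end. -/
noncomputable def listVal {ι : Type*} (z : List ι) (u : ι → ℝ) (m : ℕ) : ℝ := (z[m]?).elim 0 u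

theorem listVal_of_lt {ι : Type*} (z : List ι) (u : ι → ℝ) {m : ℕ} (h : m < z.length) :
    listVal z u m = u z[m] := by
  simp [listVal, h]

theorem listVal_nonneg {ι : Type*} (z : List ι) {u : ι → ℝ} (hu : ∀ q, 0 ≤ u q) (m : ℕ) :
    0 ≤ listVal z u m := by
  unfold listVal
  cases z[m]? with
  | none => simp
  | some q => simpa using hu q

theorem sum_map_take_drop {ι : Type*} (z : List ι) (u : ι → ℝ) (a b : ℕ) :
    (((z.drop a).take b).map u).sum = ∑ m ∈ Finset.Ico a (a + b), listVal z u m := by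
  induction b with
  | zero => simp
  | succ b ih =>
    rw [← Nat.add_assoc, Finset.sum_Ico_succ_top (Nat.le_add_right a b), ← ih, List.take_add_one,
      List.map_append, List.sum_append, List.getElem?_drop, listVal]
    cases z[a + b]? <;> simp

theorem sum_map_eq_sum_range {ι : Type*} (z : List ι) (u : ι → ℝ) :
    (z.map u).sum = ∑ m ∈ Finset.range z.length, listVal z u m := by
  have h := sum_map_take_drop z u 0 z.length
  simpa using h

theorem sum_ite_mem_list {ι : Type*} [Fintype ι] [DecidableEq ι] {l : List ι} (hl : l.Nodup)
    (u : ι → ℝ) : (∑ q, if q ∈ l then u q else 0) = (l.map u).sum := by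
  rw [← List.sum_toFinset u hl, ← Finset.sum_filter]
  congr 1
  ext q
  simp

/-- A sum over the positions of one column as a sum over rows. -/
theorem sum_col_eq {n : ℕ} {c : ℕ} (hc : 1 ≤ c) (u : VarIdx n → ℝ) (P : ℕ → Prop)
    [DecidablePred P] :
    (∑ q : VarIdx n, if q.col = c ∧ P q.row then u q else 0) =
      ∑ t ∈ Finset.Ico c n, if P t then triEntry u t c else 0 := by
  rw [← Finset.sum_filter, ← Finset.sum_filter]
  refine Finset.sum_bij (fun q _ => q.row) ?_ ?_ ?_ ?_
  · intro q hq
    simp only [Finset.mem_filter, Finset.mem_univ, true_and, Finset.mem_Ico] at hq ⊢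
    exact ⟨⟨hq.1 ▸ q.2.2.1, q.2.2.2⟩, hq.2⟩
  · intro q hq q' hq' h
    simp only [Finset.mem_filter, Finset.mem_univ, true_and] at hq hq'
    exact Subtype.ext (Prod.ext h (hq.1.trans hq'.1.symm))
  · intro t ht
    simp only [Finset.mem_filter, Finset.mem_Ico] at ht
    exact ⟨⟨(t, c), hc, ht.1.1, ht.1.2⟩, Finset.mem_filter.2 ⟨Finset.mem_univ _, rfl, ht.2⟩, rfl⟩
  · intro q hq
    simp only [Finset.mem_filter, Finset.mem_univ, true_and] at hq
    rw [← hq.1, triEntry_row_col]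

theorem chunkStart_self {n : ℕ} (α : ArrIdx n → ℕ) (c : ℕ) : chunkStart α c c = 0 := by
  simp [chunkStart]

theorem chunkStart_succ {n : ℕ} (α : ArrIdx n → ℕ) {c i : ℕ} (h : c ≤ i) :
    chunkStart α c (i + 1) = chunkStart α c i + arrEntry α i c := by
  rw [chunkStart, Finset.sum_Ico_succ_top h, chunkStart]

theorem chunkStart_mono {n : ℕ} (α : ArrIdx n → ℕ) (c : ℕ) : Monotone (chunkStart α c) := by
  intro i j hij
  exact Finset.sum_le_sum_of_subset (Finset.Ico_subset_Ico le_rfl hij)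

/-- The matrix of the substitution performed by a step at column `c` when `z` is the list of
variables being cut: the cap of each chunk receives the variable of that chunk's row, and that
variable receives the sum of the chunk. -/
def substMat {n : ℕ} (α : ArrIdx n → ℕ) (z : List (VarIdx n)) (c : ℕ) : LinTri n := fun p q =>
  (if p = q then 1 else 0) + (if q.col = c ∧ cap α z c q.row = some p then 1 else 0) +
    (if p.col = c ∧ q ∈ chunk α z c p.row then 1 else 0)

/-- The action of `substMat` on real arrays. -/
noncomputable def subst {n : ℕ} (α : ArrIdx n → ℕ) (z : List (VarIdx n)) (c : ℕ)
    (u : VarIdx n → ℝ) : VarIdx n → ℝ :=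
  ((substMat α z c).map (Int.cast : ℤ → ℝ)).mulVec u

theorem subst_apply {n : ℕ} (α : ArrIdx n → ℕ) (z : List (VarIdx n)) (c : ℕ) (u : VarIdx n → ℝ)
    (p : VarIdx n) :
    subst α z c u p = u p + (∑ q, if q.col = c ∧ cap α z c q.row = some p then u q else 0) +
      (if p.col = c then ∑ q, if q ∈ chunk α z c p.row then u q else 0 else 0) := by
  simp only [subst, Matrix.mulVec, dotProduct, Matrix.map_apply, substMat, Int.cast_add,
    Int.cast_ite, Int.cast_one, Int.cast_zero, add_mul, ite_mul, one_mul, zero_mul,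
    Finset.sum_add_distrib, Finset.sum_ite_eq, Finset.mem_univ, if_true]
  congr 1
  split_ifs with h <;> simp [h]

theorem subst_nonneg {n : ℕ} (α : ArrIdx n → ℕ) (z : List (VarIdx n)) (c : ℕ) {u : VarIdx n → ℝ}
    (hu : ∀ q, 0 ≤ u q) (p : VarIdx n) : 0 ≤ subst α z c u p := by
  rw [subst_apply]
  refine add_nonneg (add_nonneg (hu p) (Finset.sum_nonneg fun q _ => ?_)) ?_
  · split_ifs
    · exact hu q
    · exact le_rfl
  · split_ifs
    · refine Finset.sum_nonneg fun q _ => ?_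
      split_ifs
      · exact hu q
      · exact le_rfl
    · exact le_rfl

theorem mem_of_mem_chunk {n : ℕ} {α : ArrIdx n → ℕ} {z : List (VarIdx n)} {c i : ℕ}
    {q : VarIdx n} (h : q ∈ chunk α z c i) : q ∈ z :=
  List.mem_of_mem_drop (List.mem_of_mem_take h)

theorem mem_of_cap_eq_some {n : ℕ} {α : ArrIdx n → ℕ} {z : List (VarIdx n)} {c i : ℕ}
    {q : VarIdx n} (h : cap α z c i = some q) : q ∈ z :=
  List.mem_of_getElem? h

theorem mem_chunk_iff {n : ℕ} {α : ArrIdx n → ℕ} {z : List (VarIdx n)} {c i : ℕ} (hci : c ≤ i)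
    {q : VarIdx n} :
    q ∈ chunk α z c i ↔
      ∃ m, chunkStart α c i ≤ m ∧ m < chunkStart α c (i + 1) ∧ z[m]? = some q := by
  unfold chunk
  rw [chunkStart_succ α hci, List.mem_iff_getElem?]
  constructor
  · rintro ⟨m, hm⟩
    rw [List.getElem?_take] at hm
    split_ifs at hm with h
    rw [List.getElem?_drop] at hm
    exact ⟨_, Nat.le_add_right _ _, by omega, hm⟩
  · rintro ⟨m, h1, h2, h3⟩
    refine ⟨m - chunkStart α c i, ?_⟩
    rw [List.getElem?_take, if_pos (by omega), List.getElem?_drop, ← h3]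
    congr 1
    omega

/-- The hypotheses under which a step cuts the list `z` at column `c`: all caps exist. -/
structure IsCut {n : ℕ} (α : ArrIdx n → ℕ) (z : List (VarIdx n)) (c : ℕ) : Prop where
  one_le : 1 ≤ c
  nodup : z.Nodup
  col_lt : ∀ q ∈ z, q.col < c
  lt_length : chunkStart α c n < z.length

namespace IsCut

variable {n : ℕ} {α : ArrIdx n → ℕ} {z : List (VarIdx n)} {c : ℕ}

theorem cs_lt (h : IsCut α z c) {i : ℕ} (hi : i ≤ n) : chunkStart α c i < z.length :=
  lt_of_le_of_lt (chunkStart_mono α c hi) h.lt_length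

theorem cap_eq_some_iff (h : IsCut α z c) {i m : ℕ} (hi : i < n) (hm : m < z.length) :
    cap α z c i = some z[m] ↔ chunkStart α c (i + 1) = m := by
  unfold cap
  have := h.cs_lt (i := i + 1) hi
  rw [List.getElem?_eq_getElem this, Option.some_inj, h.nodup.getElem_inj_iff]

theorem listVal_subst (h : IsCut α z c) (u : VarIdx n → ℝ) {m : ℕ} (hm : m < z.length) :
    listVal z (subst α z c u) m = listVal z u m +
      ∑ t ∈ Finset.Ico c n, if chunkStart α c (t + 1) = m then triEntry u t c else 0 := by
  rw [listVal_of_lt _ _ hm, listVal_of_lt _ _ hm, subst_apply,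
    if_neg (h.col_lt _ (List.getElem_mem hm)).ne, add_zero,
    sum_col_eq h.one_le u (fun i => cap α z c i = some z[m])]
  congr 1
  refine Finset.sum_congr rfl fun t ht => ?_
  simp only [h.cap_eq_some_iff (Finset.mem_Ico.1 ht).2 hm]

theorem triEntry_subst (h : IsCut α z c) (u : VarIdx n → ℝ) {t : ℕ} (hct : c ≤ t) (htn : t < n) :
    triEntry (subst α z c u) t c = triEntry u t c +
      ∑ m ∈ Finset.Ico (chunkStart α c t) (chunkStart α c (t + 1)), listVal z u m := by
  obtain ⟨p, rfl, hp⟩ := exists_row_col h.one_le hct htn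
  have e : ∀ v : VarIdx n → ℝ, triEntry v p.row c = v p := fun v => by
    rw [← hp, triEntry_row_col]
  rw [e, e, subst_apply, if_pos hp]
  have h0 : (∑ q : VarIdx n, if q.col = c ∧ cap α z c q.row = some p then u q else 0) = 0 := by
    refine Finset.sum_eq_zero fun q _ => if_neg ?_
    rintro ⟨-, hq⟩
    exact (h.col_lt _ (mem_of_cap_eq_some hq)).ne hp
  rw [h0, add_zero, sum_ite_mem_list, chunkStart_succ α hct, ← sum_map_take_drop]
  · rfl
  · exact (h.nodup.sublist (List.drop_sublist _ _)).sublist (List.take_sublist _ _)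

theorem subst_of_notMem {u : VarIdx n → ℝ} {p : VarIdx n} (hp : p.col ≠ c)
    (hz : p ∉ z) : subst α z c u p = u p := by
  rw [subst_apply, if_neg hp, add_zero, Finset.sum_eq_zero, add_zero]
  intro q _
  exact if_neg fun hq => hz (mem_of_cap_eq_some hq.2)

/-- Prefix sums of the list being cut, in terms of the pieces. -/
theorem sum_listVal_subst (h : IsCut α z c) (u : VarIdx n → ℝ) {s : ℕ} (hs : s ≤ z.length) :
    ∑ m ∈ Finset.range s, listVal z (subst α z c u) m = ∑ m ∈ Finset.range s, listVal z u m +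
      ∑ t ∈ Finset.Ico c n, if chunkStart α c (t + 1) < s then triEntry u t c else 0 := by
  rw [Finset.sum_congr rfl fun m hm =>
    h.listVal_subst u (lt_of_lt_of_le (Finset.mem_range.1 hm) hs), Finset.sum_add_distrib,
    Finset.sum_comm]
  congr 1
  refine Finset.sum_congr rfl fun t _ => ?_
  rw [Finset.sum_ite_eq]
  simp only [Finset.mem_range]

/-- Prefix sums of the column that cuts, in terms of the pieces. -/
theorem sum_triEntry_subst (h : IsCut α z c) (u : VarIdx n → ℝ) {i : ℕ} (hci : c ≤ i)
    (hin : i ≤ n) :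
    ∑ t ∈ Finset.Ico c i, triEntry (subst α z c u) t c =
      ∑ m ∈ Finset.range (chunkStart α c i), listVal z u m +
        ∑ t ∈ Finset.Ico c i, triEntry u t c := by
  induction i, hci using Nat.le_induction with
  | base => simp [chunkStart_self]
  | succ i hci ih =>
    rw [Finset.sum_Ico_succ_top hci, Finset.sum_Ico_succ_top hci, ih (by omega),
      h.triEntry_subst u hci (by omega),
      ← Finset.sum_range_add_sum_Ico _ (chunkStart_mono α c (Nat.le_succ i))]
    ring

theorem det_substMat (h : IsCut α z c) : (substMat α z c).det = 1 := by
  have hc0 : ∀ (p : VarIdx n) (i : ℕ), p.col = c → p ∉ chunk α z c i := fun p i hp hm =>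
    (h.col_lt p (mem_of_mem_chunk hm)).ne hp
  have hk0 : ∀ (p : VarIdx n) (i : ℕ), p.col = c → cap α z c i ≠ some p := fun p i hp hm =>
    (h.col_lt p (mem_of_cap_eq_some hm)).ne hp
  -- Number the pieces on the line: place `m` of the list has weight `2 m + 1`, and the variable of
  -- a row comes just before the cap of its chunk.
  refine det_eq_one_of_weight _
    (fun q => if q.col = c then 2 * chunkStart α c (q.row + 1) else 2 * z.idxOf q + 1) ?_ ?_
  · intro p
    rw [substMat, if_pos rfl, if_neg (fun hp => hk0 p _ hp.1 hp.2),
      if_neg (fun hp => hc0 p _ hp.1 hp.2)]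
    rfl
  · intro p q hpq hne
    rw [substMat, if_neg hpq, zero_add] at hne
    by_cases h1 : q.col = c ∧ cap α z c q.row = some p
    · have hp : p.col ≠ c := fun hp => hk0 p _ hp h1.2
      have : z.idxOf p = chunkStart α c (q.row + 1) := by
        obtain ⟨hlt, hget⟩ := List.getElem?_eq_some_iff.1 h1.2
        rw [← hget, h.nodup.idxOf_getElem]
      simp only [if_pos h1.1, if_neg hp, this]
      omega
    · rw [if_neg h1, zero_add] at hne
      have h2 : p.col = c ∧ q ∈ chunk α z c p.row := by
        by_contra h2
        exact hne (if_neg h2)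
      have hq : q.col ≠ c := fun hq => hc0 q _ hq h2.2
      have hcp : c ≤ p.row := h2.1 ▸ p.2.2.1
      obtain ⟨m, -, hm2, hm3⟩ := (mem_chunk_iff hcp).1 h2.2
      have : z.idxOf q = m := by
        obtain ⟨hlt, hget⟩ := List.getElem?_eq_some_iff.1 hm3
        rw [← hget, h.nodup.idxOf_getElem]
      simp only [if_pos h2.1, if_neg hq, this]
      omega

theorem det_substMat_real (h : IsCut α z c) :
    ((substMat α z c).map (Int.cast : ℤ → ℝ)).det = 1 := by
  have := (Int.castRingHom ℝ).map_det (substMat α z c)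
  rw [h.det_substMat] at this
  simpa using this.symm

theorem subst_injective (h : IsCut α z c) : Function.Injective (subst α z c) :=
  Matrix.mulVec_injective_iff_isUnit.2 ((Matrix.isUnit_iff_isUnit_det _).2
    (by rw [h.det_substMat_real]; exact isUnit_one))

theorem subst_surjective (h : IsCut α z c) : Function.Surjective (subst α z c) :=
  Matrix.mulVec_surjective_iff_isUnit.2 ((Matrix.isUnit_iff_isUnit_det _).2
    (by rw [h.det_substMat_real]; exact isUnit_one))

end IsCut

/-! ### Existence and uniqueness of a cut -/

namespace IsCut

variable {n : ℕ} {α β : ArrIdx n → ℕ} {z : List (VarIdx n)} {c : ℕ}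

/-- A cut preserves the sum of the variables, because every new variable is cut off from a cap. -/
theorem sum_col_lt_subst (h : IsCut α z c) (u : VarIdx n → ℝ) :
    (∑ p : VarIdx n, if p.col < c then subst α z c u p else 0) =
      ∑ p : VarIdx n, if p.col < c + 1 then u p else 0 := by
  have h1 : ∀ p : VarIdx n, (if p.col < c then subst α z c u p else 0) =
      (if p.col < c then u p else 0) +
        ∑ q : VarIdx n, if q.col = c ∧ cap α z c q.row = some p then u q else 0 := by
    intro p
    by_cases hp : p.col < c
    · rw [if_pos hp, if_pos hp, subst_apply, if_neg hp.ne, add_zero]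
    · rw [if_neg hp, if_neg hp, Finset.sum_eq_zero, add_zero]
      intro q _
      exact if_neg fun hq => hp (h.col_lt _ (mem_of_cap_eq_some hq.2))
  have h2 : ∀ q : VarIdx n, (∑ p : VarIdx n, if q.col = c ∧ cap α z c q.row = some p
      then u q else 0) = if q.col = c then u q else 0 := by
    intro q
    by_cases hq : q.col = c
    · have hlt := h.cs_lt (i := q.row + 1) q.2.2.2
      have : cap α z c q.row = some z[chunkStart α c (q.row + 1)] :=
        List.getElem?_eq_getElem hlt
      simp [hq, this]
    · simp [hq]
  simp only [h1, Finset.sum_add_distrib]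
  rw [Finset.sum_comm]
  simp only [h2]
  rw [← Finset.sum_add_distrib]
  refine Finset.sum_congr rfl fun p _ => ?_
  split_ifs <;> first | omega | simp

/-- The column that cuts fits into the list being cut. -/
theorem sum_triEntry_subst_le (h : IsCut α z c) (hcn : c ≤ n) {u : VarIdx n → ℝ}
    (hu : ∀ q, 0 ≤ u q) :
    ∑ t ∈ Finset.Ico c n, triEntry (subst α z c u) t c ≤ ((z.map (subst α z c u)).sum) := by
  rw [sum_map_eq_sum_range, h.sum_listVal_subst u le_rfl, h.sum_triEntry_subst u hcn le_rfl]
  refine add_le_add (Finset.sum_le_sum_of_subset_of_nonneg ?_ fun m _ _ => listVal_nonneg z hu m)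
    (Finset.sum_le_sum fun t ht => ?_)
  · exact Finset.range_subset_range.2 h.lt_length.le
  · rw [if_pos (h.cs_lt (Finset.mem_Ico.1 ht).2)]

/-- For positive pieces each cut falls strictly inside the piece of the list that is its cap. -/
theorem lt_sum_lt (h : IsCut α z c) {u : VarIdx n → ℝ} (hu : ∀ q, 0 < u q) {i : ℕ} (hci : c ≤ i)
    (hin : i < n) :
    ∑ m ∈ Finset.range (chunkStart α c (i + 1)), listVal z (subst α z c u) m <
        ∑ t ∈ Finset.Ico c (i + 1), triEntry (subst α z c u) t c ∧
      ∑ t ∈ Finset.Ico c (i + 1), triEntry (subst α z c u) t c <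
        ∑ m ∈ Finset.range (chunkStart α c (i + 1) + 1), listVal z (subst α z c u) m := by
  have hlt := h.cs_lt (i := i + 1) hin
  have hx : ∀ t, c ≤ t → t < n → 0 < triEntry u t c := by
    intro t h1 h2
    obtain ⟨p, rfl, hp⟩ := exists_row_col h.one_le h1 h2
    rw [← hp, triEntry_row_col]
    exact hu p
  rw [h.sum_listVal_subst u hlt.le, h.sum_listVal_subst u hlt,
    h.sum_triEntry_subst u (by omega) hin, ← Finset.sum_filter, ← Finset.sum_filter]
  constructor
  · refine (add_lt_add_iff_left _).2 (Finset.sum_lt_sum_of_subset (i := i) ?_ ?_ ?_ ?_ ?_)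
    · intro t ht
      simp only [Finset.mem_filter, Finset.mem_Ico] at ht ⊢
      refine ⟨ht.1.1, ?_⟩
      by_contra hti
      have := chunkStart_mono α c (show i + 1 ≤ t + 1 by omega)
      omega
    · simp [hci]
    · simp
    · exact hx i hci hin
    · intro t ht _
      rw [Finset.mem_Ico] at ht
      exact (hx t ht.1 (by omega)).le
  · rw [Finset.sum_range_succ]
    have h1 : ∑ t ∈ Finset.Ico c (i + 1), triEntry u t c ≤
        ∑ t ∈ Finset.Ico c n with chunkStart α c (t + 1) < chunkStart α c (i + 1) + 1,
          triEntry u t c := by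
      refine Finset.sum_le_sum_of_subset_of_nonneg ?_ ?_
      · intro t ht
        simp only [Finset.mem_filter, Finset.mem_Ico] at ht ⊢
        have := chunkStart_mono α c (show t + 1 ≤ i + 1 by omega)
        exact ⟨⟨ht.1, by omega⟩, by omega⟩
      · intro t ht _
        simp only [Finset.mem_filter, Finset.mem_Ico] at ht
        exact (hx t ht.1.1 ht.1.2).le
    have h2 : 0 < listVal z u (chunkStart α c (i + 1)) := by
      rw [listVal_of_lt _ _ hlt]
      exact hu _
    linarith

/-- The cut of a generic point determines the places of the cuts. -/
theorem chunkStart_eq (hα : IsCut α z c) (hβ : IsCut β z c) {u v : VarIdx n → ℝ}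
    (hu : ∀ q, 0 < u q) (hv : ∀ q, 0 < v q) (huv : subst α z c u = subst β z c v) {i : ℕ}
    (hci : c ≤ i) (hin : i < n) : chunkStart α c (i + 1) = chunkStart β c (i + 1) := by
  have h1 := hα.lt_sum_lt hu hci hin
  have h2 := hβ.lt_sum_lt hv hci hin
  rw [← huv] at h2
  have hmono : Monotone fun s => ∑ m ∈ Finset.range s, listVal z (subst α z c u) m := by
    intro s t hst
    exact Finset.sum_le_sum_of_subset_of_nonneg (Finset.range_subset_range.2 hst)
      fun m _ _ => listVal_nonneg z (subst_nonneg α z c fun q => (hu q).le) m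
  by_contra hne
  rcases lt_or_gt_of_ne hne with hlt | hlt
  · exact absurd (hmono (Nat.succ_le_of_lt hlt)) (not_le.2 (h2.1.trans h1.2))
  · exact absurd (hmono (Nat.succ_le_of_lt hlt)) (not_le.2 (h1.1.trans h2.2))

theorem arrEntry_eq (hα : IsCut α z c) (hβ : IsCut β z c) {u v : VarIdx n → ℝ}
    (hu : ∀ q, 0 < u q) (hv : ∀ q, 0 < v q) (huv : subst α z c u = subst β z c v) {i : ℕ}
    (hci : c ≤ i) (hin : i < n) : arrEntry α i c = arrEntry β i c := by
  have h1 := chunkStart_eq hα hβ hu hv huv hci hin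
  have h0 : chunkStart α c i = chunkStart β c i := by
    rcases hci.eq_or_lt with rfl | hlt
    · rw [chunkStart_self, chunkStart_self]
    · obtain ⟨j, rfl⟩ : ∃ j, i = j + 1 := ⟨i - 1, by omega⟩
      exact chunkStart_eq hα hβ hu hv huv (by omega) (by omega)
  rw [chunkStart_succ α hci, chunkStart_succ β hci] at h1
  omega

/-- If every cut ends inside the closed piece that is its cap, and no earlier piece would do, the
pieces are nonnegative. -/
theorem nonneg_of_subst (h : IsCut α z c) {u : VarIdx n → ℝ}
    (hu : ∀ q, 0 ≤ subst α z c u q)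
    (hle : ∀ t, c ≤ t → t < n → ∑ t' ∈ Finset.Ico c (t + 1), triEntry (subst α z c u) t' c ≤
      ∑ m ∈ Finset.range (chunkStart α c (t + 1) + 1), listVal z (subst α z c u) m)
    (hge : ∀ t, c ≤ t → t < n → chunkStart α c t < chunkStart α c (t + 1) →
      ∑ m ∈ Finset.range (chunkStart α c (t + 1)), listVal z (subst α z c u) m ≤
        ∑ t' ∈ Finset.Ico c (t + 1), triEntry (subst α z c u) t' c) (q : VarIdx n) : 0 ≤ u q := by
  by_cases hq : q.col = c
  · have hcq : c ≤ q.row := hq ▸ q.2.2.1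
    have hqn : q.row < n := q.2.2.2
    have hval : triEntry u q.row c = u q := by rw [← hq, triEntry_row_col]
    rw [← hval]
    rcases (chunkStart_mono α c (Nat.le_succ q.row)).eq_or_lt with he | hlt
    · have := h.triEntry_subst u hcq hqn
      rw [Nat.succ_eq_add_one] at he
      -- The chunk is empty, so the new variable is the whole entry of the column.
      rw [← he, Finset.Ico_self, Finset.sum_empty, add_zero] at this
      rw [← this]
      exact triEntry_nonneg hu _ _
    -- The new variable is the distance from the start of the cap to the cut.
    · have h1 := hge q.row hcq hqn hlt
      have hl := h.cs_lt (i := q.row + 1) hqn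
      rw [h.sum_listVal_subst u hl.le, h.sum_triEntry_subst u (by omega) hqn,
        Finset.sum_Ico_succ_top hcq, ← Finset.sum_filter] at h1
      have he : (Finset.Ico c n).filter
          (fun t => chunkStart α c (t + 1) < chunkStart α c (q.row + 1)) =
          Finset.Ico c q.row := by
        ext t
        simp only [Finset.mem_filter, Finset.mem_Ico]
        constructor
        · rintro ⟨⟨h1, h2⟩, h3⟩
          refine ⟨h1, ?_⟩
          by_contra hc
          have := chunkStart_mono α c (show q.row + 1 ≤ t + 1 by omega)
          omega
        · rintro ⟨h1, h2⟩
          have := chunkStart_mono α c (show t + 1 ≤ q.row by omega)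
          have hlt' : chunkStart α c q.row < chunkStart α c (q.row + 1) := hlt
          exact ⟨⟨h1, by omega⟩, by omega⟩
      rw [he] at h1
      linarith
  · by_cases hz : q ∈ z
    · obtain ⟨m, hm, rfl⟩ := List.mem_iff_getElem.1 hz
      by_cases hex : ((Finset.Ico c n).filter (fun t => chunkStart α c (t + 1) = m)).Nonempty
      -- The remainder of the cap is the distance from the last cut in it to its end.
      · obtain ⟨i, hi, hmax⟩ := Finset.exists_max_image _ id hex
        simp only [Finset.mem_filter, Finset.mem_Ico, id] at hi hmax
        have h1 := hle i hi.1.1 hi.1.2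
        rw [hi.2, h.sum_listVal_subst u hm, h.sum_triEntry_subst u (by omega) (by omega), hi.2,
          Finset.sum_range_succ, ← Finset.sum_filter, listVal_of_lt z u hm] at h1
        have he : (Finset.Ico c n).filter (fun t => chunkStart α c (t + 1) < m + 1) =
            Finset.Ico c (i + 1) := by
          ext t
          simp only [Finset.mem_filter, Finset.mem_Ico]
          constructor
          · rintro ⟨⟨h1, h2⟩, h3⟩
            refine ⟨h1, ?_⟩
            by_contra hc
            have hge := chunkStart_mono α c (show i + 1 ≤ t + 1 by omega)
            have := hmax t ⟨⟨h1, h2⟩, by omega⟩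
            omega
          · rintro ⟨h1, h2⟩
            have := chunkStart_mono α c (show t + 1 ≤ i + 1 by omega)
            exact ⟨⟨h1, by omega⟩, by omega⟩
        rw [he] at h1
        linarith
      · have h1 := h.listVal_subst u hm
        rw [← Finset.sum_filter, Finset.not_nonempty_iff_eq_empty.1 hex, Finset.sum_empty,
          add_zero, listVal_of_lt _ _ hm, listVal_of_lt _ _ hm] at h1
        rw [← h1]
        exact hu _
    · have h1 := hu q
      rwa [subst_of_notMem hq hz] at h1

end IsCut

/-- Every nonnegative array whose column `c` fits into the list `z` arises by cutting. -/
theorem exists_cut {n : ℕ} {z : List (VarIdx n)} {c : ℕ} (hc : 1 ≤ c) (hnd : z.Nodup)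
    (hcol : ∀ q ∈ z, q.col < c) (hz : z ≠ []) (w : VarIdx n → ℝ) (hw : ∀ q, 0 ≤ w q)
    (hle : ∑ t ∈ Finset.Ico c n, triEntry w t c ≤ (z.map w).sum) :
    ∃ a : ℕ → ℕ, ∀ α : ArrIdx n → ℕ, (∀ i, c ≤ i → i < n → arrEntry α i c = a i) →
      IsCut α z c ∧ ∃ u, (∀ q, 0 ≤ u q) ∧ subst α z c u = w := by
  classical
  have hz0 : 0 < z.length := List.length_pos_iff.2 hz
  set F : ℕ → ℝ := fun s => ∑ m ∈ Finset.range s, listVal z w m with hF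
  set W : ℕ → ℝ := fun i => ∑ t ∈ Finset.Ico c i, triEntry w t c with hW
  have hWmono : Monotone W := fun i j hij =>
    Finset.sum_le_sum_of_subset_of_nonneg (Finset.Ico_subset_Ico le_rfl hij)
      fun t _ _ => triEntry_nonneg hw t c
  have hF0 : ∀ s, 0 ≤ F s := fun s => Finset.sum_nonneg fun m _ => listVal_nonneg z hw m
  have hex : ∀ i, i ≤ n → W i ≤ F (z.length - 1 + 1) := by
    intro i hi
    rw [Nat.sub_add_cancel hz0]
    calc W i ≤ W n := hWmono hi
      _ ≤ _ := hle
      _ = _ := sum_map_eq_sum_range z w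
  have hfind : ∀ i, i ≤ n → ∃ s, W i ≤ F (s + 1) := fun i hi => ⟨_, hex i hi⟩
  -- The cut point of row `i - 1` is the first place at which the list has caught up with
  -- the column.
  let s : ℕ → ℕ := fun i => if h : i ≤ n then Nat.find (hfind i h) else 0
  have hs : ∀ i (h : i ≤ n), s i = Nat.find (hfind i h) := fun i h => dif_pos h
  have hs1 : ∀ i, i ≤ n → W i ≤ F (s i + 1) := by
    intro i hi
    rw [hs i hi]
    exact Nat.find_spec (hfind i hi)
  have hs2 : ∀ i, i ≤ n → ∀ s', W i ≤ F (s' + 1) → s i ≤ s' := by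
    intro i hi s' h'
    rw [hs i hi]
    exact Nat.find_min' _ h'
  have hsc : c ≤ n → s c = 0 := by
    intro hcn
    refine Nat.le_zero.1 (hs2 c hcn 0 ?_)
    simpa [hW] using hF0 1
  have hsmono : ∀ i, i + 1 ≤ n → s i ≤ s (i + 1) := fun i hi =>
    hs2 i (by omega) _ ((hWmono (Nat.le_succ i)).trans (hs1 (i + 1) hi))
  refine ⟨fun i => s (i + 1) - s i, fun α hα => ?_⟩
  have hcs : ∀ i, c ≤ i → i ≤ n → chunkStart α c i = s i := by
    intro i hci
    induction i, hci using Nat.le_induction with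
    | base => intro h; rw [chunkStart_self, hsc h]
    | succ i hci ih =>
      intro h
      rw [chunkStart_succ α hci, ih (by omega), hα i hci h]
      exact Nat.add_sub_cancel' (hsmono i h)
  have hcut : IsCut α z c := by
    refine ⟨hc, hnd, hcol, ?_⟩
    rcases le_or_gt c n with hcn | hcn
    · rw [hcs n hcn le_rfl]
      have := hs2 n le_rfl _ (hex n le_rfl)
      omega
    · rw [chunkStart, Finset.Ico_eq_empty (by omega), Finset.sum_empty]
      exact hz0
  obtain ⟨u, hu⟩ := hcut.subst_surjective w
  refine ⟨hcut, u, hcut.nonneg_of_subst ?_ ?_ ?_, hu⟩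
  · rw [hu]; exact hw
  · intro t h1 h2
    rw [hu, hcs (t + 1) (by omega) h2]
    exact hs1 (t + 1) h2
  · intro t h1 h2 h3
    rw [hcs t h1 h2.le, hcs (t + 1) (by omega) h2] at h3
    rw [hu, hcs (t + 1) (by omega) h2]
    by_contra hlt
    rw [not_le] at hlt
    obtain ⟨s', hs'⟩ : ∃ s', s (t + 1) = s' + 1 := ⟨s (t + 1) - 1, by omega⟩
    have := hs2 (t + 1) h2 s' (by rw [hs'] at hlt; exact hlt.le)
    omega

/-! ### The triangles of the construction -/

/-- The columns beyond `m + 1` still hold their initial variables after `m` steps. -/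
theorem stageTri_of_lt_col {n : ℕ} (ord : LinearOrder (VarIdx n)) (α : ArrIdx n → ℕ) (m : ℕ)
    {p : VarIdx n} (hp : m + 1 < p.col) (q : VarIdx n) :
    stageTri ord α m p q = if p = q then 1 else 0 := by
  induction m with
  | zero => rw [stageTri, initTri, Matrix.one_apply]
  | succ m ih =>
    rw [stageTri, stepTri, if_neg (by omega), if_neg (by omega), ih (by omega)]

theorem mem_rowVars {n : ℕ} {ord : LinearOrder (VarIdx n)} {M : LinTri n} {k : ℕ} {q : VarIdx n} :
    q ∈ rowVars ord M k ↔ ∃ p : VarIdx n, p.row = k ∧ M p q ≠ 0 := by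
  simp [rowVars]

theorem col_of_mem_rowVars {n : ℕ} {ord : LinearOrder (VarIdx n)} {M : LinTri n} {k : ℕ}
    (hM : ∀ p q : VarIdx n, p.col ≤ k → k < q.col → M p q = 0) {q : VarIdx n}
    (hq : q ∈ rowVars ord M k) : q.col ≤ k := by
  obtain ⟨p, hp, hne⟩ := mem_rowVars.1 hq
  by_contra h
  exact hne (hM p q (hp ▸ p.2.2.1) (not_le.1 h))

theorem nodup_rowVars {n : ℕ} (ord : LinearOrder (VarIdx n)) (M : LinTri n) (k : ℕ) :
    (rowVars ord M k).Nodup := Finset.sort_nodup _ _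

theorem length_rowVars {n : ℕ} (ord : LinearOrder (VarIdx n)) (M : LinTri n) (k : ℕ) :
    (rowVars ord M k).length =
      (Finset.univ.filter (fun q : VarIdx n => ∃ p : VarIdx n, p.row = k ∧ M p q ≠ 0)).card :=
  Finset.length_sort _

/-- The variables of the columns beyond `m + 1` do not occur in the earlier columns before they are
used. -/
theorem stageTri_eq_zero {n : ℕ} (ord : LinearOrder (VarIdx n)) (α : ArrIdx n → ℕ) (m : ℕ)
    (p q : VarIdx n) (hp : p.col ≤ m + 1) (hq : m + 1 < q.col) : stageTri ord α m p q = 0 := by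
  induction m generalizing p q with
  | zero =>
    rw [stageTri, initTri, Matrix.one_apply_ne]
    rintro rfl
    omega
  | succ m ih =>
    rw [stageTri, stepTri]
    split_ifs with h1 h2 h3
    · omega
    · rw [ih p q h1 (by omega), add_zero]
    · rw [stageTri_of_lt_col ord α m (by omega), if_neg (by rintro rfl; omega), zero_add]
      refine Finset.sum_eq_zero fun x _ => if_neg ?_
      rintro ⟨-, hx⟩
      have := col_of_mem_rowVars ih (mem_of_mem_chunk hx)
      omega
    · omega

/-- A step is a linear substitution of the variables: the replacements in the old columns and in the
new column may be carried out simultaneously, as the two groups of columns involve disjoint sets of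
variables. -/
theorem stageTri_succ {n : ℕ} (ord : LinearOrder (VarIdx n)) (α : ArrIdx n → ℕ) (m : ℕ) :
    stageTri ord α (m + 1) =
      stageTri ord α m * substMat α (rowVars ord (stageTri ord α m) (m + 1)) (m + 2) := by
  have hz := stageTri_eq_zero ord α m
  ext p q
  set M := stageTri ord α m with hM
  set z := rowVars ord M (m + 1) with hzdef
  have hzc : ∀ q ∈ z, q.col ≤ m + 1 := fun q hq => col_of_mem_rowVars hz hq
  have hmul : (M * substMat α z (m + 2)) p q = M p q +
      (∑ x, if q.col = m + 2 ∧ cap α z (m + 2) q.row = some x then M p x else 0) +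
      ∑ x : VarIdx n, if x.col = m + 2 ∧ q ∈ chunk α z (m + 2) x.row then M p x else 0 := by
    simp only [Matrix.mul_apply, substMat, mul_add, mul_ite, mul_one, mul_zero,
      Finset.sum_add_distrib, Finset.sum_ite_eq', Finset.mem_univ, if_true]
  rw [hmul, stageTri, ← hM, stepTri]
  simp only [← hzdef, show m + 1 + 1 = m + 2 from rfl]
  by_cases h1 : p.col ≤ m + 1
  · rw [if_pos h1]
    have h3 : (∑ x : VarIdx n,
        if x.col = m + 2 ∧ q ∈ chunk α z (m + 2) x.row then M p x else 0) = 0 := by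
      refine Finset.sum_eq_zero fun x _ => ?_
      split_ifs with hx
      · exact hz p x h1 (by omega)
      · rfl
    rw [h3, add_zero]
    congr 1
    by_cases hq : q.col = m + 2
    · cases hc : cap α z (m + 2) q.row with
      | none => simp [hq]
      | some x => simp [hq]
    · simp [hq]
  · have h2 : (∑ x, if q.col = m + 2 ∧ cap α z (m + 2) q.row = some x then M p x else 0) = 0 := by
      refine Finset.sum_eq_zero fun x _ => ?_
      split_ifs with hx
      · have := hzc x (mem_of_cap_eq_some hx.2)
        rw [hM, stageTri_of_lt_col ord α m (by omega), if_neg (by rintro rfl; omega)]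
      · rfl
    rw [if_neg h1, h2, add_zero]
    split_ifs with h3
    · rfl
    · rw [Finset.sum_eq_zero, add_zero]
      intro x _
      split_ifs with hx
      · rw [hM, stageTri_of_lt_col ord α m (by omega), if_neg (by rintro rfl; omega)]
      · rfl

/-- The inequalities defining `arraySet` that concern the columns up to `m + 1`, which are those
used in the first `m` steps. -/
def AdmUpTo {n : ℕ} (α : ArrIdx n → ℕ) (m : ℕ) : Prop :=
  ∀ k : ℕ, 2 ≤ k → k ≤ m + 1 → k < n →
    ∑ i ∈ Finset.Ico k n, arrEntry α i k ≤ (k - 2) + ∑ j ∈ Finset.Ico 2 k, arrEntry α (k - 1) j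

theorem AdmUpTo.mono {n : ℕ} {α : ArrIdx n → ℕ} {m m' : ℕ} (h : AdmUpTo α m) (hm : m' ≤ m) :
    AdmUpTo α m' := fun k h1 h2 h3 => h k h1 (by omega) h3

/-- The properties of the triangle after `m` steps that drive the construction: its coefficients
are nonnegative, every variable occurs at most once, with coefficient one, in the part formed by the
rows from `m + 1` on of the columns up to `m + 1`, and the number of variables in each row of that
part is determined by the row of `α`. -/
structure StageInv {n : ℕ} (M : LinTri n) (α : ArrIdx n → ℕ) (m : ℕ) : Prop where
  nonneg : ∀ p q, 0 ≤ M p q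
  le_one : ∀ p q : VarIdx n, m + 1 ≤ p.row → p.col ≤ m + 1 → M p q ≤ 1
  unique : ∀ p p' q : VarIdx n, m + 1 ≤ p.row → p.col ≤ m + 1 → m + 1 ≤ p'.row →
    p'.col ≤ m + 1 → M p q ≠ 0 → M p' q ≠ 0 → p = p'
  card_row : ∀ r, m + 1 ≤ r → r < n →
    (Finset.univ.filter (fun q : VarIdx n => ∃ p : VarIdx n, p.row = r ∧ p.col ≤ m + 1 ∧
      M p q ≠ 0)).card = m + 1 + ∑ j ∈ Finset.Ico 2 (m + 2), arrEntry α r j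

theorem StageInv.length_rowVars {n : ℕ} {ord : LinearOrder (VarIdx n)} {M : LinTri n}
    {α : ArrIdx n → ℕ} {m : ℕ} (h : StageInv M α m) (hm : m + 1 < n) :
    (rowVars ord M (m + 1)).length = m + 1 + ∑ j ∈ Finset.Ico 2 (m + 2), arrEntry α (m + 1) j := by
  rw [_root_.length_rowVars, ← h.card_row (m + 1) le_rfl hm]
  congr 1
  ext q
  simp only [Finset.mem_filter, Finset.mem_univ, true_and]
  constructor
  · rintro ⟨p, hp, hne⟩
    exact ⟨p, hp, hp ▸ p.2.2.1, hne⟩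
  · rintro ⟨p, hp, -, hne⟩
    exact ⟨p, hp, hne⟩

/-- All caps of a step exist exactly when the inequality of the next column holds. -/
theorem StageInv.isCut_iff {n : ℕ} {ord : LinearOrder (VarIdx n)} {α : ArrIdx n → ℕ} {m : ℕ}
    (h : StageInv (stageTri ord α m) α m) (hm : m + 2 < n) :
    IsCut α (rowVars ord (stageTri ord α m) (m + 1)) (m + 2) ↔
      ∑ i ∈ Finset.Ico (m + 2) n, arrEntry α i (m + 2) ≤
        m + ∑ j ∈ Finset.Ico 2 (m + 2), arrEntry α (m + 1) j := by
  have hl := h.length_rowVars (ord := ord) (by omega)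
  constructor
  · intro hc
    have := hc.lt_length
    rw [chunkStart, hl] at this
    omega
  · intro hle
    refine ⟨by omega, nodup_rowVars _ _ _, fun q hq => ?_, ?_⟩
    · have := col_of_mem_rowVars (stageTri_eq_zero ord α m) hq
      omega
    · rw [chunkStart, hl]
      omega

theorem stageInv_zero {n : ℕ} (ord : LinearOrder (VarIdx n)) (α : ArrIdx n → ℕ) :
    StageInv (stageTri ord α 0) α 0 := by
  have hM : ∀ p q : VarIdx n, stageTri ord α 0 p q = if p = q then 1 else 0 := fun p q => by
    rw [stageTri, initTri, Matrix.one_apply]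
  refine ⟨fun p q => ?_, fun p q _ _ => ?_, fun p p' q _ _ _ _ h h' => ?_, fun r hr hrn => ?_⟩
  · rw [hM]; split_ifs <;> simp
  · rw [hM]; split_ifs <;> simp
  · rw [hM] at h h'
    simp only [ne_eq, ite_eq_right_iff, one_ne_zero, imp_false, not_not] at h h'
    rw [h, h']
  · obtain ⟨p, hp, hpc⟩ := exists_row_col (n := n) le_rfl hr hrn
    have : (Finset.univ.filter (fun q : VarIdx n => ∃ p : VarIdx n, p.row = r ∧ p.col ≤ 0 + 1 ∧
        stageTri ord α 0 p q ≠ 0)) = {p} := by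
      ext q
      simp only [hM, Finset.mem_filter, Finset.mem_univ, true_and, Finset.mem_singleton, ne_eq,
        ite_eq_right_iff, one_ne_zero, imp_false, not_not]
      constructor
      · rintro ⟨x, hx, hxc, rfl⟩
        have h1 : 1 ≤ x.col := x.2.1
        exact Subtype.ext (Prod.ext (hx.trans hp.symm) (show x.col = p.col by omega))
      · rintro rfl
        exact ⟨q, hp, hpc.le, rfl⟩
    rw [this]
    simp

theorem IsCut.chunk_disjoint {n : ℕ} {α : ArrIdx n → ℕ} {z : List (VarIdx n)} {c : ℕ}
    (h : IsCut α z c) {i j : ℕ} {q : VarIdx n} (hi : c ≤ i) (hj : c ≤ j)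
    (h1 : q ∈ chunk α z c i) (h2 : q ∈ chunk α z c j) : i = j := by
  obtain ⟨m, hm1, hm2, hm3⟩ := (mem_chunk_iff hi).1 h1
  obtain ⟨m', hm1', hm2', hm3'⟩ := (mem_chunk_iff hj).1 h2
  obtain ⟨hl, he⟩ := List.getElem?_eq_some_iff.1 hm3
  obtain ⟨hl', he'⟩ := List.getElem?_eq_some_iff.1 hm3'
  have hmm : m = m' := h.nodup.getElem_inj_iff.1 (he.trans he'.symm)
  by_contra hne
  rcases lt_or_gt_of_ne hne with hlt | hlt
  · have := chunkStart_mono α c (show i + 1 ≤ j by omega)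
    omega
  · have := chunkStart_mono α c (show j + 1 ≤ i by omega)
    omega

theorem IsCut.length_chunk {n : ℕ} {α : ArrIdx n → ℕ} {z : List (VarIdx n)} {c : ℕ}
    (h : IsCut α z c) {i : ℕ} (hi : c ≤ i) (hin : i < n) :
    (chunk α z c i).length = arrEntry α i c := by
  have := h.cs_lt (i := i + 1) hin
  rw [chunkStart_succ α hi] at this
  rw [chunk, List.length_take, List.length_drop]
  omega

theorem IsCut.nodup_chunk {n : ℕ} {α : ArrIdx n → ℕ} {z : List (VarIdx n)} {c : ℕ}
    (h : IsCut α z c) (i : ℕ) : (chunk α z c i).Nodup :=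
  (h.nodup.sublist (List.drop_sublist _ _)).sublist (List.take_sublist _ _)

/-- The lower rows of the old columns do not change in a step: a cap occurs in the row being cut,
hence in no lower row. -/
theorem stageTri_succ_of_col_le {n : ℕ} {ord : LinearOrder (VarIdx n)} {α : ArrIdx n → ℕ} {m : ℕ}
    (h : StageInv (stageTri ord α m) α m) {p : VarIdx n} (hr : m + 2 ≤ p.row)
    (hc : p.col ≤ m + 1) (q : VarIdx n) : stageTri ord α (m + 1) p q = stageTri ord α m p q := by
  rw [stageTri, stepTri, if_pos hc]
  split_ifs with hq
  · cases hcap : cap α (rowVars ord (stageTri ord α m) (m + 1)) (m + 1 + 1) q.row with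
    | none => simp
    | some x =>
      obtain ⟨p0, hp0, hne⟩ := mem_rowVars.1 (mem_of_cap_eq_some hcap)
      have : stageTri ord α m p x = 0 := by
        by_contra hne'
        have := h.unique p p0 x (by omega) hc hp0.ge (hp0 ▸ p0.2.2.1) hne' hne
        rw [this] at hr
        omega
      simp [this]
  · rw [add_zero]

theorem stageTri_succ_of_col_eq {n : ℕ} (ord : LinearOrder (VarIdx n)) (α : ArrIdx n → ℕ) (m : ℕ)
    {p : VarIdx n} (hc : p.col = m + 2) (q : VarIdx n) :
    stageTri ord α (m + 1) p q = (if p = q then 1 else 0) +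
      if q ∈ chunk α (rowVars ord (stageTri ord α m) (m + 1)) (m + 2) p.row then 1 else 0 := by
  rw [stageTri, stepTri, if_neg (by omega), if_pos hc, stageTri_of_lt_col ord α m (by omega)]
  congr 1
  have : ∀ x : VarIdx n, stageTri ord α m p x = if p = x then 1 else 0 :=
    fun x => stageTri_of_lt_col ord α m (by omega) x
  rw [Finset.sum_eq_single p]
  · simp only [this, if_true, hc, true_and]
  · intro x _ hx
    simp [this, hx.symm]
  · simp

/-- The entry `x_{r,m+2}` and its chunk are new in row `r` of the lower left part: the chunk
consists of variables of row `m + 1`, which occur in no lower row. -/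
theorem StageInv.succ {n : ℕ} {ord : LinearOrder (VarIdx n)} {α : ArrIdx n → ℕ} {m : ℕ}
    (h : StageInv (stageTri ord α m) α m)
    (hcut : IsCut α (rowVars ord (stageTri ord α m) (m + 1)) (m + 2)) :
    StageInv (stageTri ord α (m + 1)) α (m + 1) := by
  have hzero := stageTri_eq_zero ord α m
  have F1 := fun {p : VarIdx n} => stageTri_succ_of_col_le h (p := p)
  have F2 := fun {p : VarIdx n} => stageTri_succ_of_col_eq ord α m (p := p)
  set M := stageTri ord α m with hM
  set z := rowVars ord M (m + 1) with hz
  set M' := stageTri ord α (m + 1) with hM'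
  have hchunk : ∀ (p q : VarIdx n) (i : ℕ), m + 2 ≤ p.row → p.col ≤ m + 1 →
      q ∈ chunk α z (m + 2) i → M p q = 0 := by
    intro p q i hr hc hq
    obtain ⟨p0, hp0, hne⟩ := mem_rowVars.1 (mem_of_mem_chunk hq)
    by_contra hne'
    have := h.unique p p0 q (by omega) hc hp0.ge (hp0 ▸ p0.2.2.1) hne' hne
    rw [this] at hr
    omega
  have hnc : ∀ (q : VarIdx n) (i : ℕ), q.col = m + 2 → q ∉ chunk α z (m + 2) i := by
    intro q i hq hm
    exact (hcut.col_lt q (mem_of_mem_chunk hm)).ne hq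
  have F2' : ∀ p q : VarIdx n, p.col = m + 2 → M' p q ≠ 0 →
      p = q ∨ q ∈ chunk α z (m + 2) p.row := by
    intro p q hp hne
    rw [F2 hp] at hne
    by_contra hcon
    rw [not_or] at hcon
    rw [if_neg hcon.1, if_neg hcon.2] at hne
    exact hne rfl
  have hmix : ∀ p p' q : VarIdx n, m + 2 ≤ p.row → p.col ≤ m + 1 → p'.col = m + 2 →
      M' p q ≠ 0 → M' p' q ≠ 0 → False := by
    intro p p' q hr hc hc' h1 h2
    rw [F1 hr hc] at h1
    rcases F2' p' q hc' h2 with rfl | hq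
    · exact h1 (hzero p p' hc (by omega))
    · exact h1 (hchunk p q _ hr hc hq)
  refine ⟨fun p q => ?_, fun p q hr hc => ?_, fun p p' q hr hc hr' hc' h1 h2 => ?_,
    fun r hr hrn => ?_⟩
  · rw [hM', stageTri_succ, Matrix.mul_apply]
    refine Finset.sum_nonneg fun x _ => mul_nonneg (h.nonneg p x) ?_
    unfold substMat
    split_ifs <;> simp
  · rcases Nat.lt_or_ge p.col (m + 2) with hlt | hge
    · rw [F1 hr (by omega)]
      exact h.le_one p q (by omega) (by omega)
    · have hpc : p.col = m + 2 := by omega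
      rw [F2 hpc]
      split_ifs with h1 h2 h2
      · exact absurd h2 (hnc q _ (h1 ▸ hpc))
      all_goals simp
  · rcases Nat.lt_or_ge p.col (m + 2) with hlt | hge <;>
      rcases Nat.lt_or_ge p'.col (m + 2) with hlt' | hge'
    · rw [F1 hr (by omega)] at h1
      rw [F1 hr' (by omega)] at h2
      exact h.unique p p' q (by omega) (by omega) (by omega) (by omega) h1 h2
    · exact (hmix p p' q hr (by omega) (by omega) h1 h2).elim
    · exact (hmix p' p q hr' (by omega) (by omega) h2 h1).elim
    · have hpc : p.col = m + 2 := by omega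
      have hpc' : p'.col = m + 2 := by omega
      rcases F2' p q hpc h1 with h4 | hq <;> rcases F2' p' q hpc' h2 with h3 | hq'
      · exact h4.trans h3.symm
      · exact absurd hq' (hnc _ _ (h4 ▸ hpc))
      · exact absurd hq (hnc _ _ (h3 ▸ hpc'))
      · have := hcut.chunk_disjoint (by omega) (by omega) hq hq'
        exact Subtype.ext (Prod.ext this (hpc.trans hpc'.symm))
  · obtain ⟨x, hx, hxc⟩ := exists_row_col (n := n) (i := r) (j := m + 2) (by omega) hr hrn
    have hset : (Finset.univ.filter (fun q : VarIdx n => ∃ p : VarIdx n, p.row = r ∧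
        p.col ≤ m + 1 + 1 ∧ M' p q ≠ 0)) =
        (Finset.univ.filter (fun q : VarIdx n => ∃ p : VarIdx n, p.row = r ∧ p.col ≤ m + 1 ∧
          M p q ≠ 0)) ∪ ({x} ∪ (chunk α z (m + 2) r).toFinset) := by
      ext q
      simp only [Finset.mem_filter, Finset.mem_univ, true_and, Finset.mem_union,
        Finset.mem_singleton, List.mem_toFinset]
      constructor
      · rintro ⟨p, hp, hpc, hne⟩
        rcases Nat.lt_or_ge p.col (m + 2) with hlt | hge
        · rw [F1 (by omega) (by omega)] at hne
          exact Or.inl ⟨p, hp, by omega, hne⟩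
        · have hpx : p = x := Subtype.ext (Prod.ext (hp.trans hx.symm)
            (show p.col = x.col by omega))
          rcases F2' p q (by omega) hne with rfl | hq
          · exact Or.inr (Or.inl hpx)
          · exact Or.inr (Or.inr (hp ▸ hq))
      · rintro (⟨p, hp, hpc, hne⟩ | rfl | hq)
        · exact ⟨p, hp, by omega, by rwa [F1 (by omega) hpc]⟩
        · exact ⟨_, hx, by omega, by rw [F2 hxc, if_pos rfl]; split_ifs <;> simp⟩
        · refine ⟨x, hx, by omega, ?_⟩
          rw [F2 hxc, hx, if_pos hq]
          split_ifs <;> simp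
    rw [hset, Finset.card_union_of_disjoint, Finset.card_union_of_disjoint,
      h.card_row r (by omega) hrn, Finset.card_singleton,
      List.toFinset_card_of_nodup (hcut.nodup_chunk r), hcut.length_chunk hr hrn,
      Finset.sum_Ico_succ_top (show 2 ≤ m + 2 by omega)]
    · omega
    · rw [Finset.disjoint_singleton_left, List.mem_toFinset]
      exact hnc x _ hxc
    · rw [Finset.disjoint_left]
      intro q hq hq'
      simp only [Finset.mem_filter, Finset.mem_univ, true_and, Finset.mem_union,
        Finset.mem_singleton, List.mem_toFinset] at hq hq'
      obtain ⟨p, hp, hpc, hne⟩ := hq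
      rcases hq' with rfl | hq'
      · exact hne (hzero p q hpc (by omega))
      · exact hne (hchunk p q _ (by omega) hpc hq')

theorem stageInv {n : ℕ} (ord : LinearOrder (VarIdx n)) {α : ArrIdx n → ℕ} {m : ℕ}
    (hα : AdmUpTo α m) (hm : m + 2 ≤ n) : StageInv (stageTri ord α m) α m := by
  induction m with
  | zero => exact stageInv_zero ord α
  | succ m ih =>
    have h := ih (hα.mono (Nat.le_succ m)) (by omega)
    exact h.succ ((h.isCut_iff (by omega)).2 (hα (m + 2) (by omega) le_rfl (by omega)))

theorem isCut_stageTri {n : ℕ} (ord : LinearOrder (VarIdx n)) {α : ArrIdx n → ℕ} {m : ℕ}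
    (hα : AdmUpTo α (m + 1)) (hm : m + 2 < n) :
    IsCut α (rowVars ord (stageTri ord α m) (m + 1)) (m + 2) :=
  ((stageInv ord (hα.mono (Nat.le_succ m)) (by omega)).isCut_iff hm).2
    (hα (m + 2) (by omega) le_rfl hm)

/-! ### Cutting the polytope column by column -/

/-- The sum of column `k` of a triangular array. -/
noncomputable def colSum {n : ℕ} (u : VarIdx n → ℝ) (k : ℕ) : ℝ :=
  ∑ i ∈ Finset.Ico k n, triEntry u i k

/-- The sum of row `k` of a triangular array. -/
noncomputable def rowSum {n : ℕ} (u : VarIdx n → ℝ) (k : ℕ) : ℝ :=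
  ∑ j ∈ Finset.Ico 1 (k + 1), triEntry u k j

theorem rowSum_eq {n k : ℕ} (hk : k < n) (u : VarIdx n → ℝ) :
    rowSum u k = ∑ p : VarIdx n, if p.row = k then u p else 0 := by
  rw [← Finset.sum_filter, rowSum]
  symm
  refine Finset.sum_bij (fun q _ => q.col) ?_ ?_ ?_ ?_
  · intro q hq
    simp only [Finset.mem_filter, Finset.mem_univ, true_and, Finset.mem_Ico] at hq ⊢
    have h1 : 1 ≤ q.col := q.2.1
    have h2 : q.col ≤ q.row := q.2.2.1
    omega
  · intro q hq q' hq' h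
    simp only [Finset.mem_filter, Finset.mem_univ, true_and] at hq hq'
    exact Subtype.ext (Prod.ext (hq.trans hq'.symm) h)
  · intro j hj
    rw [Finset.mem_Ico] at hj
    exact ⟨⟨(k, j), hj.1, by omega, hk⟩, Finset.mem_filter.2 ⟨Finset.mem_univ _, rfl⟩, rfl⟩
  · intro q hq
    simp only [Finset.mem_filter, Finset.mem_univ, true_and] at hq
    rw [← hq, triEntry_row_col]

theorem colSum_eq {n k : ℕ} (hk : 1 ≤ k) (u : VarIdx n → ℝ) :
    colSum u k = ∑ p : VarIdx n, if p.col = k then u p else 0 := by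
  have := sum_col_eq hk u (fun _ => True)
  simpa [colSum] using this.symm

/-- The point of the space of triangular arrays obtained from `u` by the triangle after `m`
steps. -/
noncomputable def stageApply {n : ℕ} (ord : LinearOrder (VarIdx n)) (α : ArrIdx n → ℕ) (m : ℕ)
    (u : VarIdx n → ℝ) : VarIdx n → ℝ :=
  ((stageTri ord α m).map (Int.cast : ℤ → ℝ)).mulVec u

theorem stageApply_zero {n : ℕ} (ord : LinearOrder (VarIdx n)) (α : ArrIdx n → ℕ)
    (u : VarIdx n → ℝ) : stageApply ord α 0 u = u := by
  rw [stageApply, stageTri, initTri, Matrix.map_one _ Int.cast_zero Int.cast_one,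
    Matrix.one_mulVec]

theorem stageApply_succ {n : ℕ} (ord : LinearOrder (VarIdx n)) (α : ArrIdx n → ℕ) (m : ℕ)
    (u : VarIdx n → ℝ) : stageApply ord α (m + 1) u =
      stageApply ord α m (subst α (rowVars ord (stageTri ord α m) (m + 1)) (m + 2) u) := by
  have h := Matrix.map_mul (L := stageTri ord α m)
    (M := substMat α (rowVars ord (stageTri ord α m) (m + 1)) (m + 2)) (f := Int.castRingHom ℝ)
  rw [stageApply, stageApply, subst, Matrix.mulVec_mulVec, stageTri_succ]
  exact congrArg (fun A => A.mulVec u) h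

/-- After `m` steps the sum of row `m + 1` is the sum of the variables occurring in it. -/
theorem rowSum_stageApply {n : ℕ} {ord : LinearOrder (VarIdx n)} {α : ArrIdx n → ℕ} {m : ℕ}
    (h : StageInv (stageTri ord α m) α m) (hm : m + 1 < n) (u : VarIdx n → ℝ) :
    rowSum (stageApply ord α m u) (m + 1) =
      ((rowVars ord (stageTri ord α m) (m + 1)).map u).sum := by
  rw [rowSum_eq hm, ← sum_ite_mem_list (nodup_rowVars _ _ _)]
  have h1 : ∀ p : VarIdx n, (if p.row = m + 1 then stageApply ord α m u p else 0) =
      ∑ q, (if p.row = m + 1 then (stageTri ord α m p q : ℝ) else 0) * u q := by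
    intro p
    split_ifs
    · rfl
    · simp
  rw [Finset.sum_congr rfl fun p _ => h1 p, Finset.sum_comm]
  refine Finset.sum_congr rfl fun q _ => ?_
  rw [← Finset.sum_mul]
  split_ifs with hq
  · obtain ⟨p, hp, hne⟩ := mem_rowVars.1 hq
    have hval : stageTri ord α m p q = 1 := by
      have h1 := h.nonneg p q
      have h2 := h.le_one p q hp.ge (hp ▸ p.2.2.1)
      omega
    rw [Finset.sum_eq_single p]
    · rw [if_pos hp, hval]
      simp
    · intro p' _ hpp'
      split_ifs with hp'
      · by_contra hne'
        refine hpp' (h.unique p' p q hp'.ge (hp' ▸ p'.2.2.1) hp.ge (hp ▸ p.2.2.1) ?_ hne)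
        intro h0
        rw [h0] at hne'
        exact hne' Int.cast_zero
      · rfl
    · simp
  · rw [Finset.sum_eq_zero, zero_mul]
    intro p _
    split_ifs with hp
    · by_contra hne
      refine hq (mem_rowVars.2 ⟨p, hp, fun h0 => ?_⟩)
      rw [h0] at hne
      exact hne Int.cast_zero
    · rfl

/-- The points whose images under the triangle after `m` steps are to form the polytope: the
variables of the columns up to `m + 1` range over a unit simplex, the other columns obey the
inequalities of the polytope. -/
structure StageRegion {n : ℕ} (ord : LinearOrder (VarIdx n)) (α : ArrIdx n → ℕ) (m : ℕ)
    (u : VarIdx n → ℝ) : Prop where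
  nonneg : ∀ q, 0 ≤ u q
  sum_le : (∑ q : VarIdx n, if q.col < m + 2 then u q else 0) ≤ 1
  colSum_le : ∀ k, m + 2 ≤ k → k < n → colSum u k ≤ rowSum (stageApply ord α m u) (k - 1)

/-- The image of the polytope in the space of triangular arrays, described by inequalities. -/
structure FlowRegion {n : ℕ} (y : VarIdx n → ℝ) : Prop where
  nonneg : ∀ q, 0 ≤ y q
  colSum_one : colSum y 1 ≤ 1
  colSum_le : ∀ k, 2 ≤ k → k < n → colSum y k ≤ rowSum y (k - 1)

theorem arrEntry_row_col {n : ℕ} (α : ArrIdx n → ℕ) (p : ArrIdx n) :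
    arrEntry α p.row p.col = α p := by
  unfold arrEntry TriIdx.row TriIdx.col
  rw [dif_pos p.2]
  rfl

theorem stageRegion_zero {n : ℕ} (ord : LinearOrder (VarIdx n)) (α : ArrIdx n → ℕ)
    (y : VarIdx n → ℝ) : StageRegion ord α 0 y ↔ FlowRegion y := by
  have hs : (∑ q : VarIdx n, if q.col < 0 + 2 then y q else 0) = colSum y 1 := by
    rw [colSum_eq le_rfl]
    refine Finset.sum_congr rfl fun q _ => ?_
    have h1 : 1 ≤ q.col := q.2.1
    have : q.col < 0 + 2 ↔ q.col = 1 := by omega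
    simp only [this]
  constructor
  · rintro ⟨h1, h2, h3⟩
    refine ⟨h1, hs ▸ h2, fun k hk hkn => ?_⟩
    have := h3 k hk hkn
    rwa [stageApply_zero] at this
  · rintro ⟨h1, h2, h3⟩
    refine ⟨h1, hs.trans_le h2, fun k hk hkn => ?_⟩
    rw [stageApply_zero]
    exact h3 k hk hkn

theorem stageRegion_last {n : ℕ} (hn : 2 ≤ n) (ord : LinearOrder (VarIdx n)) (α : ArrIdx n → ℕ)
    (u : VarIdx n → ℝ) : StageRegion ord α (n - 2) u ↔ u ∈ unitSimplex n := by
  have hs : (∑ q : VarIdx n, if q.col < n - 2 + 2 then u q else 0) = ∑ q, u q := by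
    refine Finset.sum_congr rfl fun q _ => if_pos ?_
    have h1 : q.col ≤ q.row := q.2.2.1
    have h2 : q.row < n := q.2.2.2
    omega
  constructor
  · rintro ⟨h1, h2, -⟩
    exact ⟨h1, hs ▸ h2⟩
  · rintro ⟨h1, h2⟩
    exact ⟨h1, hs.trans_le h2, fun k hk hkn => by omega⟩

/-- The inequality of column `m + 2` is equivalent to the existence of the cut, which is why it
disappears from the description of the region. -/
theorem stageRegion_succ {n : ℕ} {ord : LinearOrder (VarIdx n)} {α : ArrIdx n → ℕ} {m : ℕ}
    (h : StageInv (stageTri ord α m) α m)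
    (hcut : IsCut α (rowVars ord (stageTri ord α m) (m + 1)) (m + 2)) (hm : m + 2 < n)
    {u : VarIdx n → ℝ} (hu : ∀ q, 0 ≤ u q) :
    StageRegion ord α m (subst α (rowVars ord (stageTri ord α m) (m + 1)) (m + 2) u) ↔
      StageRegion ord α (m + 1) u := by
  set z := rowVars ord (stageTri ord α m) (m + 1) with hz
  have hcol : ∀ k, m + 3 ≤ k → colSum (subst α z (m + 2) u) k = colSum u k := by
    intro k hk
    rw [colSum_eq (by omega), colSum_eq (by omega)]
    refine Finset.sum_congr rfl fun p _ => ?_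
    split_ifs with hp
    · refine IsCut.subst_of_notMem (by omega) fun hpz => ?_
      have := hcut.col_lt p hpz
      omega
    · rfl
  constructor
  · rintro ⟨h1, h2, h3⟩
    refine ⟨hu, ?_, fun k hk hkn => ?_⟩
    · rwa [hcut.sum_col_lt_subst] at h2
    · have := h3 k (by omega) hkn
      rwa [hcol k (by omega), ← stageApply_succ] at this
  · rintro ⟨-, h2, h3⟩
    refine ⟨subst_nonneg _ _ _ hu, ?_, fun k hk hkn => ?_⟩
    · rwa [hcut.sum_col_lt_subst]
    · rcases hk.eq_or_lt with rfl | hlt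
      · rw [show m + 2 - 1 = m + 1 from rfl, rowSum_stageApply h (by omega)]
        exact hcut.sum_triEntry_subst_le hm.le hu
      · rw [hcol k (by omega), ← stageApply_succ]
        exact h3 k hlt hkn

theorem admUpTo_of_mem {n : ℕ} {α : ArrIdx n → ℕ} (hα : α ∈ arraySet n) (m : ℕ) : AdmUpTo α m :=
  fun k h1 _ h3 => hα k h1 h3

theorem flowRegion_stageApply {n : ℕ} {ord : LinearOrder (VarIdx n)} {α : ArrIdx n → ℕ} {m : ℕ}
    (hα : AdmUpTo α m) (hm : m + 2 ≤ n) {u : VarIdx n → ℝ} (hu : StageRegion ord α m u) :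
    FlowRegion (stageApply ord α m u) := by
  induction m generalizing u with
  | zero => rwa [stageApply_zero, ← stageRegion_zero ord α]
  | succ m ih =>
    rw [stageApply_succ]
    refine ih (hα.mono (Nat.le_succ m)) (by omega) ?_
    rwa [stageRegion_succ (stageInv ord (hα.mono (Nat.le_succ m)) (by omega))
      (isCut_stageTri ord hα hm) hm hu.nonneg]

theorem flowRegion_mapL {n : ℕ} (hn : 2 ≤ n) {ord : LinearOrder (VarIdx n)} {α : ArrIdx n → ℕ}
    (hα : α ∈ arraySet n) {u : VarIdx n → ℝ} (hu : u ∈ unitSimplex n) :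
    FlowRegion (mapL ord α u) :=
  flowRegion_stageApply (admUpTo_of_mem hα _) (by omega) ((stageRegion_last hn ord α u).2 hu)

theorem chunkStart_congr {n : ℕ} {α β : ArrIdx n → ℕ} {c : ℕ}
    (h : ∀ i, arrEntry α i c = arrEntry β i c) (i : ℕ) : chunkStart α c i = chunkStart β c i :=
  Finset.sum_congr rfl fun t _ => h t

theorem cap_congr {n : ℕ} {α β : ArrIdx n → ℕ} {c : ℕ}
    (h : ∀ i, arrEntry α i c = arrEntry β i c) (z : List (VarIdx n)) (i : ℕ) :
    cap α z c i = cap β z c i := by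
  rw [cap, cap, chunkStart_congr h]

theorem chunk_congr {n : ℕ} {α β : ArrIdx n → ℕ} {c : ℕ}
    (h : ∀ i, arrEntry α i c = arrEntry β i c) (z : List (VarIdx n)) (i : ℕ) :
    chunk α z c i = chunk β z c i := by
  rw [chunk, chunk, chunkStart_congr h, h]

theorem substMat_congr {n : ℕ} {α β : ArrIdx n → ℕ} {c : ℕ}
    (h : ∀ i, arrEntry α i c = arrEntry β i c) (z : List (VarIdx n)) :
    substMat α z c = substMat β z c := by
  funext p q
  simp only [substMat, cap_congr h, chunk_congr h]

/-- The triangle after `m` steps depends only on the columns of `α` up to `m + 1`. -/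
theorem stageTri_congr {n : ℕ} (ord : LinearOrder (VarIdx n)) {α β : ArrIdx n → ℕ} {m : ℕ}
    (h : ∀ i j, j ≤ m + 1 → arrEntry α i j = arrEntry β i j) :
    stageTri ord α m = stageTri ord β m := by
  induction m with
  | zero => rfl
  | succ m ih =>
    rw [stageTri_succ, stageTri_succ, ih fun i j hj => h i j (by omega),
      substMat_congr fun i => h i (m + 2) le_rfl]

/-- Every point of the region is reached by some array: the columns of the array are found one
after the other, each by cutting the list of the previous row. -/
theorem exists_stageApply_eq {n : ℕ} (ord : LinearOrder (VarIdx n)) {y : VarIdx n → ℝ}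
    (hy : FlowRegion y) (m : ℕ) (hm : m + 2 ≤ n) :
    ∃ α : ArrIdx n → ℕ, AdmUpTo α m ∧ ∃ u, StageRegion ord α m u ∧ stageApply ord α m u = y := by
  induction m with
  | zero =>
    refine ⟨0, fun k h1 h2 => by omega, y, (stageRegion_zero ord 0 y).2 hy, stageApply_zero _ _ _⟩
  | succ m ih =>
    obtain ⟨α, hα, w, hw, hwy⟩ := ih (by omega)
    have hinv := stageInv ord hα (by omega)
    set z := rowVars ord (stageTri ord α m) (m + 1) with hz
    have hlen : z ≠ [] := by
      rw [← List.length_pos_iff, hz, hinv.length_rowVars (by omega)]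
      omega
    have hcol : ∀ q ∈ z, q.col < m + 2 := fun q hq => by
      have := col_of_mem_rowVars (stageTri_eq_zero ord α m) hq
      omega
    have hfit := hw.colSum_le (m + 2) le_rfl hm
    rw [show m + 2 - 1 = m + 1 from rfl, rowSum_stageApply hinv (by omega)] at hfit
    obtain ⟨a, ha⟩ := exists_cut (by omega) (nodup_rowVars _ _ _) hcol hlen w hw.nonneg hfit
    -- Overwriting column `m + 2` changes none of the first `m` steps.
    let β : ArrIdx n → ℕ := fun p => if p.col = m + 2 then a p.row else α p
    have hβ1 : ∀ i, m + 2 ≤ i → i < n → arrEntry β i (m + 2) = a i := by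
      intro i h1 h2
      rw [arrEntry, dif_pos ⟨by omega, h1, h2⟩]
      exact if_pos rfl
    have hβ2 : ∀ i j, j ≤ m + 1 → arrEntry α i j = arrEntry β i j := by
      intro i j hj
      unfold arrEntry
      split_ifs with h
      · exact (if_neg (show j ≠ m + 2 by omega)).symm
      · rfl
    have htri := stageTri_congr ord hβ2
    obtain ⟨hcut, u, hu, huw⟩ := ha β hβ1
    have hβm : AdmUpTo β m := by
      intro k h1 h2 h3
      rw [← Finset.sum_congr rfl fun i _ => hβ2 i k h2,
        ← Finset.sum_congr rfl fun j hj => hβ2 (k - 1) j (by rw [Finset.mem_Ico] at hj; omega)]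
      exact hα k h1 h2 h3
    have hinvβ := stageInv ord hβm (by omega)
    rw [htri] at hcut huw
    refine ⟨β, fun k h1 h2 h3 => ?_, u, ?_, ?_⟩
    · rcases Nat.lt_or_ge k (m + 2) with hlt | hge
      · exact hβm k h1 (by omega) h3
      · obtain rfl : k = m + 2 := by omega
        exact (hinvβ.isCut_iff hm).1 hcut
    · rw [← stageRegion_succ hinvβ hcut hm hu, huw]
      refine ⟨hw.nonneg, hw.sum_le, fun k hk hkn => ?_⟩
      rw [stageApply, ← htri]
      exact hw.colSum_le k hk hkn
    · rw [stageApply_succ, huw, ← hwy, stageApply, stageApply, htri]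

theorem exists_mapL_eq {n : ℕ} (hn : 2 ≤ n) (ord : LinearOrder (VarIdx n)) {y : VarIdx n → ℝ}
    (hy : FlowRegion y) : ∃ α ∈ arraySet n, ∃ u ∈ unitSimplex n, mapL ord α u = y := by
  obtain ⟨α, hα, u, hu, huy⟩ := exists_stageApply_eq ord hy (n - 2) (by omega)
  exact ⟨α, fun k h1 h2 => hα k h1 (by omega) h2, u, (stageRegion_last hn ord α u).1 hu, huy⟩

theorem subst_pos {n : ℕ} (α : ArrIdx n → ℕ) (z : List (VarIdx n)) (c : ℕ) {u : VarIdx n → ℝ}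
    (hu : ∀ q, 0 < u q) (p : VarIdx n) : 0 < subst α z c u p := by
  have hite : ∀ (P : Prop) [Decidable P] (q : VarIdx n), 0 ≤ if P then u q else 0 := by
    intro P _ q
    split_ifs
    · exact (hu q).le
    · exact le_rfl
  rw [subst_apply]
  refine add_pos_of_pos_of_nonneg (add_pos_of_pos_of_nonneg (hu p)
    (Finset.sum_nonneg fun q _ => hite _ q)) ?_
  split_ifs
  · exact Finset.sum_nonneg fun q _ => hite _ q
  · exact le_rfl

/-- A point with positive coordinates and the array are both determined by the image. -/
theorem eq_of_stageApply_eq {n : ℕ} {ord : LinearOrder (VarIdx n)} {α β : ArrIdx n → ℕ} {m : ℕ}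
    (hα : AdmUpTo α m) (hβ : AdmUpTo β m) (hm : m + 2 ≤ n) {u v : VarIdx n → ℝ}
    (hu : ∀ q, 0 < u q) (hv : ∀ q, 0 < v q) (huv : stageApply ord α m u = stageApply ord β m v) :
    (∀ i j, j ≤ m + 1 → arrEntry α i j = arrEntry β i j) ∧ u = v := by
  induction m generalizing u v with
  | zero =>
    rw [stageApply_zero, stageApply_zero] at huv
    refine ⟨fun i j hj => ?_, huv⟩
    rw [arrEntry, arrEntry, dif_neg (by omega), dif_neg (by omega)]
  | succ m ih =>
    rw [stageApply_succ, stageApply_succ] at huv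
    obtain ⟨h1, h2⟩ := ih (hα.mono (Nat.le_succ m)) (hβ.mono (Nat.le_succ m)) (by omega)
      (subst_pos _ _ _ hu) (subst_pos _ _ _ hv) huv
    have hcα := isCut_stageTri ord hα hm
    have hcβ := isCut_stageTri ord hβ hm
    rw [← stageTri_congr ord h1] at hcβ h2
    have h3 : ∀ i, arrEntry α i (m + 2) = arrEntry β i (m + 2) := by
      intro i
      by_cases hi : m + 2 ≤ i ∧ i < n
      · exact IsCut.arrEntry_eq hcα hcβ hu hv h2 hi.1 hi.2
      · rw [arrEntry, arrEntry, dif_neg (by omega), dif_neg (by omega)]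
    refine ⟨fun i j hj => ?_, hcα.subst_injective ?_⟩
    · rcases Nat.lt_or_ge j (m + 2) with hlt | hge
      · exact h1 i j (by omega)
      · obtain rfl : j = m + 2 := by omega
        exact h3 i
    · rw [h2, subst, subst, substMat_congr h3]

theorem eq_of_mapL_eq {n : ℕ} (hn : 2 ≤ n) {ord : LinearOrder (VarIdx n)} {α β : ArrIdx n → ℕ}
    (hα : α ∈ arraySet n) (hβ : β ∈ arraySet n) {u v : VarIdx n → ℝ}
    (hu : ∀ q, 0 < u q) (hv : ∀ q, 0 < v q) (huv : mapL ord α u = mapL ord β v) : α = β := by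
  have h := (eq_of_stageApply_eq (admUpTo_of_mem hα _) (admUpTo_of_mem hβ _)
    (show n - 2 + 2 ≤ n by omega) hu hv huv).1
  funext p
  have h1 : p.col ≤ p.row := p.2.2.1
  have h2 : p.row < n := p.2.2.2
  have h3 := h p.row p.col (by omega)
  rwa [arrEntry_row_col, arrEntry_row_col] at h3

theorem det_stageTri {n : ℕ} (ord : LinearOrder (VarIdx n)) {α : ArrIdx n → ℕ} {m : ℕ}
    (hα : AdmUpTo α m) (hm : m + 2 ≤ n) : (stageTri ord α m).det = 1 := by
  induction m with
  | zero => rw [stageTri, initTri, Matrix.det_one]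
  | succ m ih =>
    rw [stageTri_succ, Matrix.det_mul, ih (hα.mono (Nat.le_succ m)) (by omega),
      (isCut_stageTri ord hα hm).det_substMat, one_mul]

theorem det_mapL {n : ℕ} (hn : 2 ≤ n) (ord : LinearOrder (VarIdx n)) {α : ArrIdx n → ℕ}
    (hα : α ∈ arraySet n) : LinearMap.det (mapL ord α) = 1 := by
  have h := (Int.castRingHom ℝ).map_det (stageTri ord α (n - 2))
  rw [det_stageTri ord (admUpTo_of_mem hα _) (by omega), map_one] at h
  rw [mapL, ← Matrix.toLin'_apply', LinearMap.det_toLin']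
  exact h.symm

theorem finite_arraySet (n : ℕ) : (arraySet n).Finite := by
  -- The defining inequalities bound each column in terms of the earlier ones.
  have hB : ∃ B : ℕ → ℕ, ∀ α ∈ arraySet n, ∀ i j, arrEntry α i j ≤ B j := by
    have key : ∀ k : ℕ, ∃ B : ℕ → ℕ, ∀ α ∈ arraySet n, ∀ i j, j < k → arrEntry α i j ≤ B j := by
      intro k
      induction k with
      | zero => exact ⟨0, fun α _ i j hj => by omega⟩
      | succ k ih =>
        obtain ⟨B, hB⟩ := ih
        refine ⟨Function.update B k ((k - 2) + ∑ j ∈ Finset.Ico 2 k, B j), fun α hα i j hj => ?_⟩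
        rcases Nat.lt_or_ge j k with hlt | hge
        · rw [Function.update_of_ne hlt.ne]
          exact hB α hα i j hlt
        · obtain rfl : j = k := by omega
          rw [Function.update_self]
          by_cases h : 2 ≤ j ∧ j ≤ i ∧ i < n
          · calc arrEntry α i j ≤ ∑ i ∈ Finset.Ico j n, arrEntry α i j :=
                  Finset.single_le_sum (f := fun i => arrEntry α i j) (fun _ _ => Nat.zero_le _)
                    (Finset.mem_Ico.2 h.2)
              _ ≤ _ := hα j h.1 (by omega)
              _ ≤ _ := Nat.add_le_add_left (Finset.sum_le_sum fun l hl =>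
                  hB α hα _ l (Finset.mem_Ico.1 hl).2) _
          · rw [arrEntry, dif_neg h]
            exact Nat.zero_le _
    obtain ⟨B, hB⟩ := key n
    refine ⟨B, fun α hα i j => ?_⟩
    by_cases hj : j < n
    · exact hB α hα i j hj
    · rw [arrEntry, dif_neg (by omega)]
      exact Nat.zero_le _
  obtain ⟨B, hB⟩ := hB
  refine (Set.finite_Iic (fun p : ArrIdx n => B p.col)).subset fun α hα p => ?_
  have h := hB α hα p.row p.col
  rwa [arrEntry_row_col] at h

/-! ### Matrices and their triangular arrays -/

theorem triEntry_of_lt {n : ℕ} (y : VarIdx n → ℝ) {i j : ℕ} (h : i < j) : triEntry y i j = 0 :=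
  dif_neg (by omega)

theorem triEntry_of_le {n : ℕ} (y : VarIdx n → ℝ) {i j : ℕ} (h : n ≤ i) : triEntry y i j = 0 :=
  dif_neg (by omega)

theorem triEntry_add {n : ℕ} (x y : VarIdx n → ℝ) (i j : ℕ) :
    triEntry (x + y) i j = triEntry x i j + triEntry y i j := by
  unfold triEntry
  split_ifs
  · rfl
  · rw [add_zero]

theorem triEntry_smul {n : ℕ} (a : ℝ) (y : VarIdx n → ℝ) (i j : ℕ) :
    triEntry (a • y) i j = a * triEntry y i j := by
  unfold triEntry
  split_ifs
  · rfl
  · rw [mul_zero]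

theorem rowSum_add {n : ℕ} (x y : VarIdx n → ℝ) (k : ℕ) :
    rowSum (x + y) k = rowSum x k + rowSum y k := by
  simp only [rowSum, triEntry_add, Finset.sum_add_distrib]

theorem rowSum_smul {n : ℕ} (a : ℝ) (y : VarIdx n → ℝ) (k : ℕ) :
    rowSum (a • y) k = a * rowSum y k := by
  simp only [rowSum, triEntry_smul, Finset.mul_sum]

theorem colSum_add {n : ℕ} (x y : VarIdx n → ℝ) (k : ℕ) :
    colSum (x + y) k = colSum x k + colSum y k := by
  simp only [colSum, triEntry_add, Finset.sum_add_distrib]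

theorem colSum_smul {n : ℕ} (a : ℝ) (y : VarIdx n → ℝ) (k : ℕ) :
    colSum (a • y) k = a * colSum y k := by
  simp only [colSum, triEntry_smul, Finset.mul_sum]

theorem rowSum_eq_sum_fin {n : ℕ} (y : VarIdx n → ℝ) {k : ℕ} (hk : k < n) :
    rowSum y k = ∑ j : Fin n, triEntry y k (j + 1) := by
  rw [Fin.sum_univ_eq_sum_range (fun j => triEntry y k (j + 1)) n, Finset.range_eq_Ico,
    Finset.sum_Ico_add' (fun j => triEntry y k j) 0 n 1, rowSum]
  refine Finset.sum_subset (Finset.Ico_subset_Ico (by omega) (by omega)) fun j _ hj => ?_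
  rw [Finset.mem_Ico] at hj
  exact dif_neg (by omega)

theorem colSum_eq_sum_fin {n : ℕ} (y : VarIdx n → ℝ) (k : ℕ) (hk : 1 ≤ k) :
    colSum y k = ∑ i : Fin n, triEntry y (i + 1) k := by
  rw [Fin.sum_univ_eq_sum_range (fun i => triEntry y (i + 1) k) n, Finset.range_eq_Ico,
    Finset.sum_Ico_add' (fun i => triEntry y i k) 0 n 1, colSum]
  refine Finset.sum_subset (Finset.Ico_subset_Ico (by omega) (by omega)) fun j _ hj => ?_
  rw [Finset.mem_Ico] at hj
  exact dif_neg (by omega)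

/-- The `n × n` matrix with triangular array `y` whose entries vanish above the superdiagonal and
all of whose row and column sums are `t`. The superdiagonal is read off from the rows, the last row
from the columns. -/
noncomputable def fillMat {n : ℕ} (t : ℝ) (y : VarIdx n → ℝ) : Matrix (Fin n) (Fin n) ℝ :=
  fun i j =>
    if (i : ℕ) + 1 < n then
      triEntry y (i + 1) (j + 1) + (if (j : ℕ) = i + 1 then t - rowSum y (i + 1) else 0)
    else (if (j : ℕ) = 0 then t else rowSum y j) - colSum y (j + 1)

theorem fillMat_add {n : ℕ} (s t : ℝ) (x y : VarIdx n → ℝ) :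
    fillMat (s + t) (x + y) = fillMat s x + fillMat t y := by
  ext i j
  simp only [fillMat, Matrix.add_apply, triEntry_add, rowSum_add, colSum_add]
  split_ifs <;> ring

theorem fillMat_smul {n : ℕ} (a t : ℝ) (y : VarIdx n → ℝ) :
    fillMat (a * t) (a • y) = a • fillMat t y := by
  ext i j
  simp only [fillMat, Matrix.smul_apply, triEntry_smul, rowSum_smul, colSum_smul, smul_eq_mul]
  split_ifs <;> ring

/-- The linear part of the affine map `fillMat 1`. -/
noncomputable def fillLin (n : ℕ) : (VarIdx n → ℝ) →ₗ[ℝ] Matrix (Fin n) (Fin n) ℝ where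
  toFun := fillMat 0
  map_add' x y := by rw [← fillMat_add, add_zero]
  map_smul' a y := by rw [RingHom.id_apply, ← fillMat_smul, mul_zero]

theorem fillMat_one {n : ℕ} (y : VarIdx n → ℝ) : fillMat 1 y = fillMat 1 0 + fillLin n y := by
  rw [show fillLin n y = fillMat 0 y from rfl, ← fillMat_add, add_zero, zero_add]

/-- `fillMat 1` as an affine map. -/
noncomputable def fillAff (n : ℕ) : (VarIdx n → ℝ) →ᵃ[ℝ] Matrix (Fin n) (Fin n) ℝ where
  toFun := fillMat 1
  linear := fillLin n
  map_vadd' p v := by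
    rw [vadd_eq_add, vadd_eq_add, fillMat_one (v + p), fillMat_one p, map_add]
    abel

theorem fillAff_apply {n : ℕ} (y : VarIdx n → ℝ) : fillAff n y = fillMat 1 y := rfl

theorem toTri_fillMat {n : ℕ} (t : ℝ) (y : VarIdx n → ℝ) : toTri (fillMat t y) = y := by
  funext p
  have h1 : 1 ≤ p.col := p.2.1
  have h2 : p.col ≤ p.row := p.2.2.1
  have h3 : p.row < n := p.2.2.2
  simp only [toTri, fillMat]
  rw [if_pos (by omega), if_neg (by omega), add_zero, Nat.sub_add_cancel h1,
    Nat.sub_add_cancel (by omega), triEntry_row_col]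

theorem fillAff_injective (n : ℕ) : Function.Injective (fillAff n) :=
  Function.LeftInverse.injective (g := toTri) fun y => toTri_fillMat 1 y

theorem fillLin_injective (n : ℕ) : Function.Injective (fillLin n) :=
  Function.LeftInverse.injective (g := toTri) fun y => toTri_fillMat 0 y

/-- The linear conditions satisfied by the matrices in `T_n`: row and column sums are one, and the
entries above the superdiagonal vanish. -/
structure HessSums {n : ℕ} (Y : Matrix (Fin n) (Fin n) ℝ) : Prop where
  row : ∀ i, ∑ j, Y i j = 1
  col : ∀ j, ∑ i, Y i j = 1
  zero : ∀ i j : Fin n, (i : ℕ) + 2 ≤ (j : ℕ) → Y i j = 0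

theorem sum_row_fillMat {n : ℕ} (t : ℝ) (y : VarIdx n → ℝ) {i : Fin n} (hi : (i : ℕ) + 1 < n) :
    ∑ j, fillMat t y i j = t := by
  simp only [fillMat, if_pos hi, Finset.sum_add_distrib]
  rw [← rowSum_eq_sum_fin y hi, Finset.sum_eq_single (⟨i + 1, hi⟩ : Fin n)]
  · simp
  · intro j _ hj
    exact if_neg fun h => hj (Fin.ext h)
  · simp

theorem sum_col_fillMat {n : ℕ} (t : ℝ) (y : VarIdx n → ℝ) (j : Fin n) :
    ∑ i, fillMat t y i j = t := by
  have hj := j.2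
  -- The entry of the last row is separated off.
  have h1 : ∀ i : Fin n, fillMat t y i j = triEntry y (i + 1) (j + 1) +
      (if (j : ℕ) = i + 1 then t - rowSum y j else 0) +
      (if i = (⟨n - 1, by omega⟩ : Fin n) then
        (if (j : ℕ) = 0 then t else rowSum y j) - colSum y (j + 1) else 0) := by
    intro i
    unfold fillMat
    by_cases hi : (i : ℕ) + 1 < n
    · have hne : i ≠ (⟨n - 1, by omega⟩ : Fin n) := by
        intro h
        have := congrArg Fin.val h
        dsimp only at this
        omega
      rw [if_pos hi, if_neg hne, add_zero]
      by_cases h : (j : ℕ) = i + 1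
      · rw [if_pos h, if_pos h, h]
      · rw [if_neg h, if_neg h]
    · have hi' := i.2
      have hji : ¬ (j : ℕ) = i + 1 := by omega
      rw [if_neg hi, triEntry_of_le y (by omega), if_neg hji,
        if_pos (Fin.ext (show (i : ℕ) = n - 1 by omega)), add_zero, zero_add]
  simp only [h1, Finset.sum_add_distrib, Finset.sum_ite_eq', Finset.mem_univ, if_true]
  rw [← colSum_eq_sum_fin y _ (Nat.le_add_left 1 j)]
  by_cases h0 : (j : ℕ) = 0
  · rw [Finset.sum_eq_zero fun (i : Fin n) _ => if_neg (show ¬ (j : ℕ) = i + 1 by omega),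
      if_pos h0]
    ring
  · rw [if_neg h0, Finset.sum_eq_single (⟨j - 1, by omega⟩ : Fin n)]
    · rw [if_pos (by simp; omega)]
      ring
    · intro i _ hi
      exact if_neg fun h => hi (Fin.ext (show (i : ℕ) = j - 1 by omega))
    · simp

theorem eq_of_sum_eq_of_ne {ι : Type*} [Fintype ι] {f g : ι → ℝ} (i₀ : ι)
    (hs : ∑ i, f i = ∑ i, g i) (h : ∀ i, i ≠ i₀ → f i = g i) : f i₀ = g i₀ := by
  classical
  rw [← Finset.add_sum_erase _ f (Finset.mem_univ i₀),
    ← Finset.add_sum_erase _ g (Finset.mem_univ i₀),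
    Finset.sum_congr rfl fun i hi => h i (Finset.ne_of_mem_erase hi)] at hs
  exact add_right_cancel hs

theorem hessSums_fillMat {n : ℕ} (y : VarIdx n → ℝ) : HessSums (fillMat 1 y) := by
  refine ⟨fun i => ?_, sum_col_fillMat 1 y, fun i j hij => ?_⟩
  · by_cases hi : (i : ℕ) + 1 < n
    · exact sum_row_fillMat 1 y hi
    · refine eq_of_sum_eq_of_ne (f := fun i => ∑ j, fillMat 1 y i j) (g := fun _ => 1) i ?_ ?_
      · have : ∑ i, ∑ j, fillMat 1 y i j = ∑ j, ∑ i, fillMat 1 y i j := Finset.sum_comm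
        rw [this]
        simp only [sum_col_fillMat]
      · intro k hk
        have : (k : ℕ) ≠ i := fun h => hk (Fin.ext h)
        exact sum_row_fillMat 1 y (by omega)
  · have := j.2
    rw [fillMat, if_pos (by omega), triEntry_of_lt y (by omega), if_neg (by omega), add_zero]

theorem triEntry_toTri {n : ℕ} (Y : Matrix (Fin n) (Fin n) ℝ) (i j : Fin n) :
    triEntry (toTri Y) (i + 1) (j + 1) =
      if (j : ℕ) ≤ i ∧ (i : ℕ) + 1 < n then Y i j else 0 := by
  split_ifs with h
  · obtain ⟨p, hp, hpc⟩ := exists_row_col (n := n) (i := i + 1) (j := j + 1) (by omega) (by omega)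
      h.2
    rw [← hp, ← hpc, triEntry_row_col, toTri]
    congr 1
    · exact Fin.ext (show p.row - 1 = i by omega)
    · exact Fin.ext (show p.col - 1 = j by omega)
  · exact dif_neg (by omega)

theorem fillMat_toTri {n : ℕ} {Y : Matrix (Fin n) (Fin n) ℝ} (hY : HessSums Y) :
    fillMat 1 (toTri Y) = Y := by
  have hup : ∀ i j : Fin n, (i : ℕ) + 1 < n → fillMat 1 (toTri Y) i j = Y i j := by
    intro i j hi
    rw [fillMat, if_pos hi, triEntry_toTri]
    rcases lt_trichotomy (j : ℕ) (i + 1) with h | h | h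
    · rw [if_pos ⟨by omega, hi⟩, if_neg (by omega), add_zero]
    · rw [if_neg (by omega), if_pos h, zero_add, rowSum_eq_sum_fin _ hi, ← hY.row i,
        ← Finset.sum_sub_distrib, Finset.sum_eq_single j]
      · rw [triEntry_toTri, if_neg (by omega), sub_zero]
      · intro k _ hk
        have hk' : (k : ℕ) ≠ j := fun h => hk (Fin.ext h)
        rw [triEntry_toTri]
        split_ifs with h2
        · rw [sub_self]
        · rw [hY.zero i k (by omega), sub_zero]
      · simp
    · rw [if_neg (by omega), if_neg (by omega), hY.zero i j (by omega), add_zero]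
  ext i j
  by_cases hi : (i : ℕ) + 1 < n
  · exact hup i j hi
  · refine eq_of_sum_eq_of_ne (f := fun i => fillMat 1 (toTri Y) i j) (g := fun i => Y i j) i ?_ ?_
    · exact (sum_col_fillMat 1 _ j).trans (hY.col j).symm
    · intro k hk
      have : (k : ℕ) ≠ i := fun h => hk (Fin.ext h)
      exact hup k j (by omega)

/-- In the region every row sum is at most one: the flow through each cut of the triangle is at
most the flow entering in the first column. -/
theorem FlowRegion.rowSum_le_one {n : ℕ} {y : VarIdx n → ℝ} (hy : FlowRegion y) {k : ℕ}
    (hk : 1 ≤ k) (hkn : k < n) : rowSum y k ≤ 1 := by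
  have h1 : ∑ j ∈ Finset.Ico 1 (k + 1), colSum y j ≤ 1 + ∑ i ∈ Finset.Ico 1 k, rowSum y i := by
    induction k, hk using Nat.le_induction with
    | base => simpa using hy.colSum_one
    | succ k hk ih =>
      rw [Finset.sum_Ico_succ_top (show 1 ≤ k + 1 by omega) (colSum y),
        Finset.sum_Ico_succ_top hk (rowSum y)]
      have h2 := hy.colSum_le (k + 1) (by omega) hkn
      rw [Nat.add_sub_cancel] at h2
      linarith [ih (by omega)]
  have h2 : ∑ i ∈ Finset.Ico 1 (k + 1), rowSum y i ≤ ∑ j ∈ Finset.Ico 1 (k + 1), colSum y j := by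
    have hr : ∑ i ∈ Finset.Ico 1 (k + 1), rowSum y i =
        ∑ p : VarIdx n, if p.row ∈ Finset.Ico 1 (k + 1) then y p else 0 := by
      rw [Finset.sum_congr rfl fun i hi => rowSum_eq
        (show i < n by rw [Finset.mem_Ico] at hi; omega) y, Finset.sum_comm]
      refine Finset.sum_congr rfl fun p _ => ?_
      rw [Finset.sum_ite_eq]
    have hc : ∑ j ∈ Finset.Ico 1 (k + 1), colSum y j =
        ∑ p : VarIdx n, if p.col ∈ Finset.Ico 1 (k + 1) then y p else 0 := by
      rw [Finset.sum_congr rfl fun j hj => colSum_eq (Finset.mem_Ico.1 hj).1 y, Finset.sum_comm]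
      refine Finset.sum_congr rfl fun p _ => ?_
      rw [Finset.sum_ite_eq]
    rw [hr, hc]
    refine Finset.sum_le_sum fun p _ => ?_
    have hp1 : 1 ≤ p.col := p.2.1
    have hp2 : p.col ≤ p.row := p.2.2.1
    simp only [Finset.mem_Ico]
    split_ifs
    · exact le_rfl
    · omega
    · exact hy.nonneg p
    · exact le_rfl
  rw [Finset.sum_Ico_succ_top hk] at h2
  linarith

theorem FlowRegion.fillMat_nonneg {n : ℕ} {y : VarIdx n → ℝ} (hy : FlowRegion y)
    (i j : Fin n) : 0 ≤ fillMat 1 y i j := by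
  have hj := j.2
  unfold fillMat
  split_ifs with hi h h0
  · exact add_nonneg (triEntry_nonneg hy.nonneg _ _)
      (sub_nonneg.2 (hy.rowSum_le_one (by omega) hi))
  · rw [add_zero]
    exact triEntry_nonneg hy.nonneg _ _
  · rw [h0]
    exact sub_nonneg.2 hy.colSum_one
  · rcases Nat.lt_or_ge (j + 1) n with hlt | hge
    · have := hy.colSum_le (j + 1) (by omega) hlt
      rw [Nat.add_sub_cancel] at this
      exact sub_nonneg.2 this
    · have : colSum y ((j : ℕ) + 1) = 0 := by
        rw [colSum, Finset.Ico_eq_empty (by omega), Finset.sum_empty]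
      rw [this, sub_zero]
      exact Finset.sum_nonneg fun k _ => triEntry_nonneg hy.nonneg _ _

theorem flowRegion_toTri {n : ℕ} (hn : 2 ≤ n) {Y : Matrix (Fin n) (Fin n) ℝ} (hY : HessSums Y)
    (h0 : ∀ i j, 0 ≤ Y i j) : FlowRegion (toTri Y) := by
  have hlast : ∀ j : Fin n, 0 ≤ (if (j : ℕ) = 0 then 1 else rowSum (toTri Y) j) -
      colSum (toTri Y) (j + 1) := by
    intro j
    have h1 := h0 ⟨n - 1, by omega⟩ j
    rw [← fillMat_toTri hY, fillMat, if_neg (by simp; omega)] at h1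
    exact h1
  refine ⟨fun q => h0 _ _, ?_, fun k hk hkn => ?_⟩
  · have := hlast ⟨0, by omega⟩
    rw [if_pos rfl] at this
    exact sub_nonneg.1 this
  · have := hlast ⟨k - 1, by omega⟩
    rw [if_neg (by simp; omega), show ((⟨k - 1, by omega⟩ : Fin n) : ℕ) + 1 = k from
      Nat.sub_add_cancel (by omega)] at this
    exact sub_nonneg.1 this

/-- A nonnegative integral doubly stochastic matrix is a permutation matrix. -/
theorem exists_perm_of_int {n : ℕ} {Y : Matrix (Fin n) (Fin n) ℝ} (h0 : ∀ i j, 0 ≤ Y i j)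
    (hrow : ∀ i, ∑ j, Y i j = 1) (hcol : ∀ j, ∑ i, Y i j = 1) (hint : ∀ i j, ∃ m : ℤ, Y i j = m) :
    ∃ σ : Equiv.Perm (Fin n), Y = σ.permMatrix ℝ := by
  have hone : ∀ i j, Y i j ≠ 0 → 1 ≤ Y i j := by
    intro i j hne
    obtain ⟨m, hm⟩ := hint i j
    have h := h0 i j
    rw [hm] at h hne ⊢
    have h1 : 0 ≤ m := by exact_mod_cast h
    have h2 : m ≠ 0 := by exact_mod_cast hne
    exact_mod_cast (show 1 ≤ m by omega)
  have huniq : ∀ f : Fin n → ℝ, (∀ j, 0 ≤ f j) → (∀ j, f j ≠ 0 → 1 ≤ f j) → ∑ j, f j = 1 →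
      ∀ j j', f j ≠ 0 → f j' ≠ 0 → j = j' := by
    intro f hf hf1 hs j j' hj hj'
    by_contra hne
    have : ∑ x ∈ ({j, j'} : Finset (Fin n)), f x ≤ ∑ x, f x :=
      Finset.sum_le_sum_of_subset_of_nonneg (Finset.subset_univ _) fun x _ _ => hf x
    rw [Finset.sum_pair hne, hs] at this
    linarith [hf1 j hj, hf1 j' hj']
  have hex : ∀ i, ∃ j, Y i j ≠ 0 := by
    intro i
    by_contra hcon
    push Not at hcon
    have := hrow i
    rw [Finset.sum_eq_zero fun j _ => hcon j] at this
    exact zero_ne_one this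
  choose f hf using hex
  have hinj : Function.Injective f := fun i i' h =>
    huniq (fun k => Y k (f i)) (fun k => h0 _ _) (fun k => hone _ _) (hcol _) i i' (hf i)
      (by rw [h]; exact hf i')
  refine ⟨Equiv.ofBijective f (Finite.injective_iff_bijective.1 hinj), ?_⟩
  have hz : ∀ i j, f i ≠ j → Y i j = 0 := by
    intro i j hne
    by_contra h
    exact hne (huniq (Y i) (h0 i) (hone i) (hrow i) _ _ (hf i) h)
  ext i j
  rw [Equiv.Perm.permMatrix, PEquiv.toMatrix_apply]
  simp only [Equiv.toPEquiv_apply, Option.mem_some_iff, Equiv.ofBijective_apply]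
  split_ifs with h
  · subst h
    have h1 := Finset.single_le_sum (fun j _ => h0 i j) (Finset.mem_univ (f i))
    rw [hrow i] at h1
    exact le_antisymm h1 (hone _ _ (hf i))
  · exact hz i j h

theorem fillMat_int {n : ℕ} {y : VarIdx n → ℝ} (hint : ∀ p, ∃ m : ℤ, y p = m) (i j : Fin n) :
    ∃ m : ℤ, fillMat 1 y i j = m := by
  let R : Subring ℝ := (Int.castRingHom ℝ).range
  have ht : ∀ i j, triEntry y i j ∈ R := by
    intro i j
    unfold triEntry
    split_ifs
    · obtain ⟨m, hm⟩ := hint ⟨(i, j), by assumption⟩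
      exact ⟨m, hm.symm⟩
    · exact R.zero_mem
  have hr : ∀ k, rowSum y k ∈ R := fun k => R.sum_mem fun j _ => ht k j
  have hc : ∀ k, colSum y k ∈ R := fun k => R.sum_mem fun i _ => ht i k
  have : fillMat 1 y i j ∈ R := by
    unfold fillMat
    split_ifs
    · exact R.add_mem (ht _ _) (R.sub_mem R.one_mem (hr _))
    · exact R.add_mem (ht _ _) R.zero_mem
    · exact R.sub_mem R.one_mem (hc _)
    · exact R.sub_mem (hr _) (hc _)
  obtain ⟨m, hm⟩ := this
  exact ⟨m, hm.symm⟩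

theorem fillMat_mem_permSet {n : ℕ} {y : VarIdx n → ℝ} (hy : FlowRegion y)
    (hint : ∀ p, ∃ m : ℤ, y p = m) : fillMat 1 y ∈ permSet n := by
  have hH := hessSums_fillMat y
  exact ⟨exists_perm_of_int hy.fillMat_nonneg hH.row hH.col (fillMat_int hint), hH.zero⟩

theorem hessSums_of_mem_permSet {n : ℕ} {Y : Matrix (Fin n) (Fin n) ℝ} (hY : Y ∈ permSet n) :
    HessSums Y := by
  obtain ⟨⟨σ, rfl⟩, h⟩ := hY
  have hd := mem_doublyStochastic_iff_sum.1 (permMatrix_mem_doublyStochastic (R := ℝ) (σ := σ))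
  exact ⟨hd.2.1, hd.2.2, h⟩

theorem hessSums_of_mem_polytopeP {n : ℕ} {Y : Matrix (Fin n) (Fin n) ℝ} (hY : Y ∈ polytopeP n) :
    HessSums Y ∧ ∀ i j, 0 ≤ Y i j := by
  have hconv : Convex ℝ {Y : Matrix (Fin n) (Fin n) ℝ | HessSums Y ∧ ∀ i j, 0 ≤ Y i j} := by
    rintro X ⟨hX, hX0⟩ Y ⟨hY, hY0⟩ a b ha hb hab
    refine ⟨⟨fun i => ?_, fun j => ?_, fun i j hij => ?_⟩, fun i j => ?_⟩
    · simp only [Matrix.add_apply, Matrix.smul_apply, smul_eq_mul, Finset.sum_add_distrib,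
        ← Finset.mul_sum, hX.row, hY.row, mul_one, hab]
    · simp only [Matrix.add_apply, Matrix.smul_apply, smul_eq_mul, Finset.sum_add_distrib,
        ← Finset.mul_sum, hX.col, hY.col, mul_one, hab]
    · simp [hX.zero i j hij, hY.zero i j hij]
    · exact add_nonneg (mul_nonneg ha (hX0 i j)) (mul_nonneg hb (hY0 i j))
  refine convexHull_min ?_ hconv hY
  rintro _ ⟨⟨σ, rfl⟩, h⟩
  exact ⟨hessSums_of_mem_permSet ⟨⟨σ, rfl⟩, h⟩,
    (mem_doublyStochastic_iff_sum.1 (permMatrix_mem_doublyStochastic (R := ℝ) (σ := σ))).1⟩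

/-- The points of the affine lattice spanned by `T_n` have integer entries. -/
theorem hessSums_of_mem_lattice {n : ℕ} {Y : Matrix (Fin n) (Fin n) ℝ}
    (hY : Y ∈ affineSpan ℤ (permSet n)) : HessSums Y ∧ ∀ i j, ∃ m : ℤ, Y i j = m := by
  refine affineSpan_induction hY ?_ ?_
  · rintro Y hY
    refine ⟨hessSums_of_mem_permSet hY, fun i j => ?_⟩
    obtain ⟨⟨σ, rfl⟩, -⟩ := hY
    rw [Equiv.Perm.permMatrix, PEquiv.toMatrix_apply]
    split_ifs
    · exact ⟨1, by simp⟩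
    · exact ⟨0, by simp⟩
  · rintro c U V W ⟨hU, hU'⟩ ⟨hV, hV'⟩ ⟨hW, hW'⟩
    have he : ∀ i j, (c • (U -ᵥ V) +ᵥ W) i j = c * (U i j - V i j) + W i j := by
      intro i j
      rw [vsub_eq_sub, vadd_eq_add, Matrix.add_apply, Matrix.smul_apply, Matrix.sub_apply,
        zsmul_eq_mul]
    refine ⟨⟨fun i => ?_, fun j => ?_, fun i j hij => ?_⟩, fun i j => ?_⟩
    · simp only [he, Finset.sum_add_distrib, ← Finset.mul_sum, Finset.sum_sub_distrib, hU.row,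
        hV.row, hW.row, sub_self, mul_zero, zero_add]
    · simp only [he, Finset.sum_add_distrib, ← Finset.mul_sum, Finset.sum_sub_distrib, hU.col,
        hV.col, hW.col, sub_self, mul_zero, zero_add]
    · rw [he, hU.zero i j hij, hV.zero i j hij, hW.zero i j hij]
      ring
    · obtain ⟨a, ha⟩ := hU' i j
      obtain ⟨b, hb⟩ := hV' i j
      obtain ⟨d, hd⟩ := hW' i j
      exact ⟨c * (a - b) + d, by rw [he, ha, hb, hd]; push_cast; ring⟩

/-- The vertices of the simplex `L(α)(S)`: the origin and the images of the unit vectors. -/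
noncomputable def simplexVertex {n : ℕ} (ord : LinearOrder (VarIdx n)) (α : ArrIdx n → ℕ) :
    Option (VarIdx n) → VarIdx n → ℝ
  | none => 0
  | some q => mapL ord α (Pi.single q 1)

theorem simplexL_eq_convexHull {n : ℕ} (ord : LinearOrder (VarIdx n)) (α : ArrIdx n → ℕ) :
    simplexL ord α = convexHull ℝ (Set.range (simplexVertex ord α)) := by
  rw [convexHull_range_eq_image_simplex]
  refine Set.image_congr fun x _ => ?_
  conv_lhs => rw [pi_eq_sum_univ' x, map_sum]
  simp only [simplexVertex, sub_zero, zero_add, map_smul]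

theorem simplexVertex_int {n : ℕ} (ord : LinearOrder (VarIdx n)) (α : ArrIdx n → ℕ)
    (o : Option (VarIdx n)) (p : VarIdx n) : ∃ m : ℤ, simplexVertex ord α o p = m := by
  cases o with
  | none => exact ⟨0, by simp [simplexVertex]⟩
  | some q => exact ⟨stageTri ord α (n - 2) p q, by simp [simplexVertex, mapL]⟩

theorem flowRegion_simplexVertex {n : ℕ} (hn : 2 ≤ n) (ord : LinearOrder (VarIdx n))
    {α : ArrIdx n → ℕ} (hα : α ∈ arraySet n) (o : Option (VarIdx n)) :
    FlowRegion (simplexVertex ord α o) := by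
  have h : simplexVertex ord α o ∈ simplexL ord α := by
    rw [simplexL_eq_convexHull]
    exact subset_convexHull ℝ _ ⟨o, rfl⟩
  obtain ⟨u, hu, h⟩ := h
  rw [← h]
  exact flowRegion_mapL hn hα hu

theorem image_fillAff_simplexL {n : ℕ} (ord : LinearOrder (VarIdx n)) (α : ArrIdx n → ℕ) :
    fillAff n '' simplexL ord α = convexHull ℝ (Set.range (fillAff n ∘ simplexVertex ord α)) := by
  rw [simplexL_eq_convexHull, AffineMap.image_convexHull, ← Set.range_comp]

theorem image_fillAff_simplexL_subset {n : ℕ} (hn : 2 ≤ n) (ord : LinearOrder (VarIdx n))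
    {α : ArrIdx n → ℕ} (hα : α ∈ arraySet n) : fillAff n '' simplexL ord α ⊆ polytopeP n := by
  rw [image_fillAff_simplexL]
  refine convexHull_mono ?_
  rintro _ ⟨o, rfl⟩
  exact fillMat_mem_permSet (flowRegion_simplexVertex hn ord hα o) (simplexVertex_int ord α o)

/-- The region is the image of `P_n`, because the vertices of the simplices covering it come from
`T_n`. -/
theorem toTri_image_polytopeP {n : ℕ} (hn : 2 ≤ n) (ord : LinearOrder (VarIdx n)) :
    toTri '' polytopeP n = {y | FlowRegion y} := by
  apply Set.Subset.antisymm
  · rintro _ ⟨Y, hY, rfl⟩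
    obtain ⟨h1, h2⟩ := hessSums_of_mem_polytopeP hY
    exact flowRegion_toTri hn h1 h2
  · intro y hy
    obtain ⟨α, hα, u, hu, huy⟩ := exists_mapL_eq hn ord hy
    exact ⟨fillAff n y, image_fillAff_simplexL_subset hn ord hα ⟨y, ⟨u, hu, huy⟩, rfl⟩,
      toTri_fillMat 1 y⟩

theorem affineIndependent_simplexVertex {n : ℕ} (hn : 2 ≤ n) (ord : LinearOrder (VarIdx n))
    {α : ArrIdx n → ℕ} (hα : α ∈ arraySet n) : AffineIndependent ℝ (simplexVertex ord α) := by
  have hker : (mapL ord α).ker = ⊥ := by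
    refine LinearMap.ker_eq_bot.2 ?_
    have : IsUnit (LinearMap.det (mapL ord α)) := by rw [det_mapL hn ord hα]; exact isUnit_one
    exact (LinearEquiv.ofIsUnitDet (f := mapL ord α)
      (v := Pi.basisFun ℝ (VarIdx n)) (v' := Pi.basisFun ℝ (VarIdx n)) (by
        rwa [LinearMap.det_toMatrix])).injective
  rw [affineIndependent_iff_linearIndependent_vsub ℝ _ none]
  have h1 := (Pi.basisFun ℝ (VarIdx n)).linearIndependent.map' (mapL ord α) hker
  have h2 := h1.comp (fun x : {x : Option (VarIdx n) // x ≠ none} =>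
    x.1.get (Option.isSome_iff_ne_none.2 x.2)) (by
      rintro ⟨x, hx⟩ ⟨y, hy⟩ h
      exact Subtype.ext (Option.get_inj.1 h))
  convert! h2 using 1
  funext ⟨x, hx⟩
  cases x with
  | none => exact absurd rfl hx
  | some q => simp [simplexVertex]

/-! ### Volumes -/

theorem card_varIdx (n : ℕ) : Fintype.card (VarIdx n) = n.choose 2 := by
  have h : (Finset.univ : Finset (VarIdx n)).card =
      ∑ k ∈ Finset.range n, (Finset.univ.filter (fun p : VarIdx n => p.row = k)).card :=
    Finset.card_eq_sum_card_fiberwise fun p _ => Finset.mem_coe.2 (Finset.mem_range.2 p.2.2.2)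
  rw [← Finset.card_univ, h, Nat.choose_two_right, ← Finset.sum_range_id]
  refine Finset.sum_congr rfl fun k hk => ?_
  rw [Finset.mem_range] at hk
  have : (Finset.Ico 1 (k + 1)).card = k := by simp
  rw [← this]
  refine Finset.card_bij (fun p _ => p.col) ?_ ?_ ?_
  · intro p hp
    rw [this, Finset.mem_filter] at hp
    have h1 : 1 ≤ p.col := p.2.1
    have h2 : p.col ≤ p.row := p.2.2.1
    rw [Finset.mem_Ico]
    omega
  · intro p hp q hq hpq
    exact Subtype.ext (Prod.ext ((Finset.mem_filter.1 hp).2.trans (Finset.mem_filter.1 hq).2.symm)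
      hpq)
  · intro j hj
    rw [Finset.mem_Ico] at hj
    obtain ⟨p, hp, hpc⟩ := exists_row_col (n := n) hj.1 (show j ≤ k by omega) hk
    exact ⟨p, Finset.mem_filter.2 ⟨Finset.mem_univ _, by rw [hp, this]⟩, hpc⟩

/-- The volume of a set of matrices with prescribed row and column sums is a fixed multiple of the
volume of the set of their triangular arrays. -/
theorem exists_matVol_eq_mul (n : ℕ) :
    ∃ c : ENNReal, c ≠ 0 ∧ c ≠ ⊤ ∧
      ∀ A : Set (VarIdx n → ℝ), matVol n (fillAff n '' A) = c * volume A := by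
  let ι := Fin n × Fin n
  let flat : Matrix (Fin n) (Fin n) ℝ →ₗ[ℝ] EuclideanSpace ℝ ι :=
    { toFun := fun Y => WithLp.toLp 2 fun p => Y p.1 p.2
      map_add' := fun _ _ => rfl
      map_smul' := fun _ _ => rfl }
  have hflat : Function.Injective flat := by
    intro X Y h
    ext i j
    exact congrArg (fun v : EuclideanSpace ℝ ι => v (i, j)) h
  obtain ⟨c, h0, hT, hc⟩ := exists_euclideanHausdorffMeasure_image_eq_mul
    (flat ∘ₗ fillLin n) (hflat.comp (fillLin_injective n)) (flat (fillMat 1 0))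
  refine ⟨c, h0, hT, fun A => ?_⟩
  rw [← hc A, card_varIdx, matVol, Set.image_image]
  congr 1
  refine Set.image_congr fun y _ => ?_
  rw [fillAff_apply, fillMat_one]
  exact map_add flat _ _

theorem convex_unitSimplex (n : ℕ) : Convex ℝ (unitSimplex n) := convex_simplex 1

theorem convex_simplexL {n : ℕ} (ord : LinearOrder (VarIdx n)) (α : ArrIdx n → ℕ) :
    Convex ℝ (simplexL ord α) := (convex_unitSimplex n).linear_image _

theorem volume_simplexL {n : ℕ} (hn : 2 ≤ n) (ord : LinearOrder (VarIdx n)) {α : ArrIdx n → ℕ}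
    (hα : α ∈ arraySet n) :
    volume (simplexL ord α) = ((n.choose 2).factorial : ENNReal)⁻¹ := by
  rw [simplexL, Measure.addHaar_image_linearMap, det_mapL hn ord hα, abs_one, ENNReal.ofReal_one,
    one_mul, unitSimplex, volume_unit_simplex, card_varIdx]

theorem interior_unitSimplex_pos {n : ℕ} {u : VarIdx n → ℝ} (hu : u ∈ interior (unitSimplex n))
    (p : VarIdx n) : 0 < u p := by
  have h1 : unitSimplex n ⊆ (fun x : VarIdx n → ℝ => x p) ⁻¹' Set.Ici 0 := fun x hx => hx.1 p
  have h2 := interior_mono h1 hu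
  rw [← (isOpenMap_eval p).preimage_interior_eq_interior_preimage (continuous_apply p),
    interior_Ici] at h2
  exact h2

theorem disjoint_interior_simplexL {n : ℕ} (hn : 2 ≤ n) (ord : LinearOrder (VarIdx n))
    {α β : ArrIdx n → ℕ} (hα : α ∈ arraySet n) (hβ : β ∈ arraySet n) (hne : α ≠ β) :
    Disjoint (interior (simplexL ord α)) (interior (simplexL ord β)) := by
  have hint : ∀ γ ∈ arraySet n, ∀ y ∈ interior (simplexL ord γ),
      ∃ u : VarIdx n → ℝ, (∀ p, 0 < u p) ∧ mapL ord γ u = y := by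
    intro γ hγ y hy
    let e : (VarIdx n → ℝ) ≃ₗ[ℝ] (VarIdx n → ℝ) :=
      LinearEquiv.ofIsUnitDet (f := mapL ord γ) (v := Pi.basisFun ℝ (VarIdx n))
        (v' := Pi.basisFun ℝ (VarIdx n)) (by
          rw [LinearMap.det_toMatrix, det_mapL hn ord hγ]; exact isUnit_one)
    have he : simplexL ord γ = e.toContinuousLinearEquiv.toHomeomorph '' unitSimplex n := rfl
    rw [he, ← Homeomorph.image_interior] at hy
    obtain ⟨u, hu, huy⟩ := hy
    exact ⟨u, interior_unitSimplex_pos hu, huy⟩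
  rw [Set.disjoint_left]
  intro y hy1 hy2
  obtain ⟨u, hu, huy⟩ := hint α hα y hy1
  obtain ⟨v, hv, hvy⟩ := hint β hβ y hy2
  exact hne (eq_of_mapL_eq hn hα hβ hu hv (huy.trans hvy.symm))

theorem volume_inter_eq_zero_of_disjoint_interior {ι : Type*} [Fintype ι] {s t : Set (ι → ℝ)}
    (hs : Convex ℝ s) (ht : Convex ℝ t) (h : Disjoint (interior s) (interior t)) :
    volume (s ∩ t) = 0 := by
  refine measure_mono_null (t := frontier (s ∩ t)) ?_ ((hs.inter ht).addHaar_frontier volume)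
  rw [frontier, interior_inter, h.inter_eq, Set.sdiff_empty]
  exact subset_closure

theorem iUnion_simplexL {n : ℕ} (hn : 2 ≤ n) (ord : LinearOrder (VarIdx n)) :
    (⋃ α ∈ arraySet n, simplexL ord α) = toTri '' polytopeP n := by
  rw [toTri_image_polytopeP hn ord]
  ext y
  simp only [Set.mem_iUnion]
  constructor
  · rintro ⟨α, hα, u, hu, rfl⟩
    exact flowRegion_mapL hn hα hu
  · intro hy
    obtain ⟨α, hα, u, hu, huy⟩ := exists_mapL_eq hn ord hy
    exact ⟨α, hα, u, hu, huy⟩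

theorem volume_toTri_image_polytopeP {n : ℕ} (hn : 2 ≤ n) (ord : LinearOrder (VarIdx n)) :
    volume (toTri '' polytopeP n) =
      (arraySet n).ncard * ((n.choose 2).factorial : ENNReal)⁻¹ := by
  have hfin := finite_arraySet n
  have hU : (⋃ α ∈ arraySet n, simplexL ord α) = ⋃ α ∈ hfin.toFinset, simplexL ord α := by
    simp
  rw [← iUnion_simplexL hn ord, hU, measure_biUnion_finset₀]
  · rw [Finset.sum_congr rfl fun α hα => volume_simplexL hn ord (hfin.mem_toFinset.1 hα),
      Finset.sum_const, nsmul_eq_mul, Set.ncard_eq_toFinset_card _ hfin]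
  · intro α hα β hβ hne
    exact volume_inter_eq_zero_of_disjoint_interior (convex_simplexL ord α) (convex_simplexL ord β)
      (disjoint_interior_simplexL hn ord (hfin.mem_toFinset.1 hα) (hfin.mem_toFinset.1 hβ) hne)
  · exact fun α _ => (convex_simplexL ord α).nullMeasurableSet volume

theorem injOn_toTri (n : ℕ) : Set.InjOn (toTri (n := n)) (polytopeP n) := by
  intro X hX Y hY h
  rw [← fillMat_toTri (hessSums_of_mem_polytopeP hX).1, h,
    fillMat_toTri (hessSums_of_mem_polytopeP hY).1]

theorem zero_mem_arraySet (n : ℕ) : (0 : ArrIdx n → ℕ) ∈ arraySet n := by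
  intro k _ _
  have : ∀ i j, arrEntry (0 : ArrIdx n → ℕ) i j = 0 := by
    intro i j
    unfold arrEntry
    split_ifs <;> rfl
  simp [this]

/-- The smallest volume of a lattice simplex, in terms of the factor `c` between volumes of sets of
matrices and of triangular arrays: it is attained by the simplices `L(α)(S)`, whose vertices lie in
`T_n`, and no lattice simplex has smaller volume because its vertices have integer coordinates. -/
theorem isLeast_latticeSimplexVolumes {n : ℕ} (hn : 2 ≤ n) (ord : LinearOrder (VarIdx n))
    {c : ENNReal} (hc : ∀ A : Set (VarIdx n → ℝ), matVol n (fillAff n '' A) = c * volume A) :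
    IsLeast (latticeSimplexVolumes n) (c * ((n.choose 2).factorial : ENNReal)⁻¹) := by
  have e : Fin (n.choose 2 + 1) ≃ Option (VarIdx n) :=
    Fintype.equivOfCardEq (by rw [Fintype.card_fin, Fintype.card_option, card_varIdx])
  constructor
  · have h0 := zero_mem_arraySet n
    refine ⟨fillAff n ∘ simplexVertex ord 0 ∘ e, ?_, fun i => ?_, ?_⟩
    · exact ((affineIndependent_simplexVertex hn ord h0).comp_embedding e.toEmbedding).map' _
        (fillAff_injective n)
    · exact subset_affineSpan ℤ _ (fillMat_mem_permSet (flowRegion_simplexVertex hn ord h0 _)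
        (simplexVertex_int ord 0 _))
    · rw [← volume_simplexL hn ord h0, ← hc, image_fillAff_simplexL, ← Function.comp_assoc,
        e.surjective.range_comp]
  · rintro _ ⟨v, hv, hl, rfl⟩
    let w : Option (VarIdx n) → VarIdx n → ℝ := fun o => toTri (v (e.symm o))
    have hvw : v = fillAff n ∘ w ∘ e := by
      funext i
      simp only [w, Function.comp_apply, Equiv.symm_apply_apply, fillAff_apply]
      exact (fillMat_toTri (hessSums_of_mem_lattice (hl i)).1).symm
    have hw : AffineIndependent ℝ w := by
      have h1 : AffineIndependent ℝ (w ∘ e) := by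
        rw [hvw] at hv
        exact hv.of_comp (fillAff n)
      have h2 := h1.comp_embedding e.symm.toEmbedding
      convert! h2 using 1
      funext o
      simp
    have hhull : convexHull ℝ (Set.range v) = fillAff n '' convexHull ℝ (Set.range w) := by
      rw [hvw, AffineMap.image_convexHull, ← Set.range_comp, ← Function.comp_assoc,
        e.surjective.range_comp]
    rw [hhull, hc, ← card_varIdx]
    gcongr
    exact le_volume_convexHull_range_of_int w hw fun o p =>
      (hessSums_of_mem_lattice (hl (e.symm o))).2 _ _

theorem mainTheorem2 (n : ℕ) (hn : 2 ≤ n) (ord : LinearOrder (VarIdx n)) :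
    -- a point of `P_n` is determined by its triangular array
    Set.InjOn (toTri (n := n)) (polytopeP n) ∧
    (∀ α ∈ arraySet n,
      -- at every step there are more variables than the chunks use, so that all caps exist
      (∀ k : ℕ, 1 ≤ k → k + 1 < n →
        ∑ i ∈ Finset.Ico (k + 1) n, arrEntry α i (k + 1)
          < (rowVars ord (stageTri ord α (k - 1)) k).length) ∧
      -- `L(α)`, which has integer coefficients by construction, has determinant 1
      LinearMap.det (mapL ord α) = 1 ∧
      -- the simplex `L(α)(S)` lies in `P_n`
      simplexL ord α ⊆ toTri '' polytopeP n ∧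
      -- its volume is `1 / C(n,2)!` in the space of triangular arrays
      MeasureTheory.volume (simplexL ord α) = ((n.choose 2).factorial : ENNReal)⁻¹ ∧
      -- and minimal as the volume of a set of matrices
      matVol n {Y ∈ polytopeP n | toTri Y ∈ simplexL ord α} = minSimplexVol n) ∧
    -- the simplices have disjoint interiors
    (∀ α ∈ arraySet n, ∀ β ∈ arraySet n, α ≠ β →
      Disjoint (interior (simplexL ord α)) (interior (simplexL ord β))) ∧
    -- the simplices cover `P_n`
    (⋃ α ∈ arraySet n, simplexL ord α) = toTri '' polytopeP n ∧
    -- the minimum defining `v_n` is attained, and it is positive and finite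
    IsLeast (latticeSimplexVolumes n) (minSimplexVol n) ∧
    0 < minSimplexVol n ∧ minSimplexVol n < ⊤ ∧
    -- the relative volume of `P_n` is the number of arrays
    (arraySet n).Finite ∧ relVolP n = ((arraySet n).ncard : ENNReal) := by
  obtain ⟨c, hc0, hcT, hc⟩ := exists_matVol_eq_mul n
  have hleast := isLeast_latticeSimplexVolumes hn ord hc
  have hmin : minSimplexVol n = c * ((n.choose 2).factorial : ENNReal)⁻¹ := hleast.csInf_eq
  have hf0 : ((n.choose 2).factorial : ENNReal)⁻¹ ≠ 0 :=
    ENNReal.inv_ne_zero.2 (ENNReal.natCast_ne_top _)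
  have hfT : ((n.choose 2).factorial : ENNReal)⁻¹ ≠ ⊤ :=
    ENNReal.inv_ne_top.2 (by exact_mod_cast (Nat.factorial_ne_zero _))
  have hm0 : minSimplexVol n ≠ 0 := by rw [hmin]; exact mul_ne_zero hc0 hf0
  have hmT : minSimplexVol n ≠ ⊤ := by rw [hmin]; exact ENNReal.mul_ne_top hcT hfT
  refine ⟨injOn_toTri n, fun α hα => ⟨fun k hk hkn => ?_, det_mapL hn ord hα, ?_,
    volume_simplexL hn ord hα, ?_⟩, fun α hα β hβ => disjoint_interior_simplexL hn ord hα hβ,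
    iUnion_simplexL hn ord, hmin ▸ hleast, pos_iff_ne_zero.2 hm0, lt_top_iff_ne_top.2 hmT,
    finite_arraySet n, ?_⟩
  · obtain ⟨m, rfl⟩ : ∃ m, k = m + 1 := ⟨k - 1, by omega⟩
    exact (isCut_stageTri ord (admUpTo_of_mem hα _) hkn).lt_length
  · rw [← iUnion_simplexL hn ord]
    exact Set.subset_biUnion_of_mem (u := fun α => simplexL ord α) hα
  · have hset : {Y ∈ polytopeP n | toTri Y ∈ simplexL ord α} = fillAff n '' simplexL ord α := by
      ext Y
      constructor
      · rintro ⟨hY, h⟩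
        exact ⟨_, h, fillMat_toTri (hessSums_of_mem_polytopeP hY).1⟩
      · rintro ⟨y, hy, rfl⟩
        refine ⟨image_fillAff_simplexL_subset hn ord hα ⟨y, hy, rfl⟩, ?_⟩
        rwa [fillAff_apply, toTri_fillMat]
    rw [hset, hc, volume_simplexL hn ord hα, hmin]
  · have hP : polytopeP n = fillAff n '' (toTri '' polytopeP n) := by
      rw [Set.image_image]
      refine Eq.trans (Set.image_id' _).symm (Set.image_congr fun Y hY => ?_)
      exact (fillMat_toTri (hessSums_of_mem_polytopeP hY).1).symm
    have hvol : matVol n (polytopeP n) = (arraySet n).ncard * minSimplexVol n := by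
      rw [hP, hc, volume_toTri_image_polytopeP hn ord, hmin]
      ring
    rw [relVolP, hvol, ENNReal.mul_div_cancel_right hm0 hmT]
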